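/- Let $N\ge k\ge 2$ and let $N$ parties, each with an input bit $x_i$ and an outcome bit $a_i$, be grouped into $k$ disjoint nonempty clusters $\mathcal S_1,\dots,\mathcal S_k$ covering all parties. A strategy consists of complex Hilbert spaces $\mathcal H_1,\dots,\mathcal H_k$ (one per cluster, of arbitrary dimension), a purifying Hilbert space $\mathcal P$, a unit vector $|\psi\rangle\in\mathcal H_1\otimes\dots\otimes\mathcal H_k\otimes\mathcal P$ (a purification of the shared state), and, for every cluster $j$ and every input string $\vec x_{\mathcal S_j}$, an arbitrary joint POVM $\{\Pi^{(j)}_{\vec a_{\mathcal S_j}|\vec x_{\mathcal S_j}}\}_{\vec a_{\mathcal S_j}}$ on $\mathcal H_j$. It realizes the correlations $p(\vec a|\vec x)=\langle\psi|\bigotimes_j\Pi^{(j)}_{\vec a_{\mathcal S_j}|\vec x_{\mathcal S_j}}\otimes\mathbb 1_{\mathcal P}|\psi\rangle$. The observable of cluster $j$ is $M^{(j)}_{\vec x_{\mathcal S_j}}=\sum_{\vec a_{\mathcal S_j}}(-1)^{\sum_{i\in\mathcal S_j}a_i}\,\Pi^{(j)}_{\vec a_{\mathcal S_j}|\vec x_{\mathcal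 S_j}}$. Write $|\vec x|$ for the Hamming weight. For a sign $s\in\{+1,-1\}$ the Svetlichny expression is $$S_N^{s}(p)=\sum_{\vec x\in\{0,1\}^N}(-1)^{|\vec x|(|\vec x|+s)/2}\sum_{\vec a\in\{0,1\}^N}(-1)^{\sum_i a_i}\,p(\vec a|\vec x).$$ Let $|\mathrm{GHZ}_k\rangle=(|0\cdots0\rangle+|1\cdots1\rangle)/\sqrt2$, let $P_w=\sigma_x,\sigma_y,-\sigma_x,-\sigma_y$ for $w\equiv0,1,2,3 \pmod 4$, and for $\sigma\in\{+1,-1\}$ define the target observables $$\bar A^{(1)}_{\vec x_{\mathcal S_1}}=\frac{\sigma}{\sqrt2}\bigl(P_{w}+s\,P_{w+1}\bigr),\ w=|\vec x_{\mathcal S_1}|,\qquad \bar A^{(j)}_{\vec x_{\mathcal S_j}}=P_{|\vec x_{\mathcal S_j}|}\quad(j=2,\dots,k).$$ Then, for each $s$: 1. Every $p$ realized by a strategy satisfies $|S_N^{s}(p)|\le 2^{N-1}\sqrt2$, and for each $\sigma$ the value $\sigma\,2^{N-1}\sqrt2$ is attained by the state $|\mathrm{GHZ}_k\rangle$ with the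 observables $\bar A^{(j)}$, i.e. $\sum_{\vec x}(-1)^{|\vec x|(|\vec x|+s)/2}\langle \mathrm{GHZ}_k|\bigotimes_j\bar A^{(j)}_{\vec x_{\mathcal S_j}}|\mathrm{GHZ}_k\rangle=\sigma\,2^{N-1}\sqrt2$. 2. If $S_N^{s}(p)=\sigma\,2^{N-1}\sqrt2$ (maximal violation), then $p$ self-tests the $k$-partite GHZ state shared by the clusters, together with the observables $\bar A^{(j)}$: for every strategy realizing $p$ there are isometries $\Lambda_j:\mathcal H_j\to\mathbb C^2\otimes\mathcal H_j$ ($j=1,\dots,k$) and a unit vector $|\zeta\rangle\in\mathcal H_1\otimes\dots\otimes\mathcal H_k\otimes\mathcal P$ such that, with $\Lambda=\Lambda_1\otimes\dots\otimes\Lambda_k\otimes\mathbb 1_{\mathcal P}$ and after reordering tensor factors, $$\Lambda|\psi\rangle=|\mathrm{GHZ}_k\rangle\otimes|\zeta\rangle$$ and, for all $\vec x\in\{0,1\}^N$, $$\Lambda\Bigl(\bigotimes_jM^{(j)}_{\vec x_{\mathcal S_j}}\otimes\mathbb 1_{\mathcal P}\,|\psi\rangle\Bigr)=\Bigl(\bigotimes_j\bar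 A^{(j)}_{\vec x_{\mathcal S_j}}|\mathrm{GHZ}_k\rangle\Bigr)\otimes|\zeta\rangle .$$ -/

import Mathlib

universe u v

noncomputable section

/-! ### Hilbert tensor products -/

/-- `t` exhibits the Hilbert space `K` as the (completed) Hilbert tensor product of the
spaces `H o`: the inner product of elementary tensors is the product of the inner products, and
elementary tensors span a dense subspace.  This determines `(K, t)` up to a unique unitary. -/
structure IsHilbertTensorProduct {O : Type*} [Fintype O] {H : O → Type*}
    [∀ o, NormedAddCommGroup (H o)] [∀ o, InnerProductSpace ℂ (H o)]
    {K : Type*} [NormedAddCommGroup K] [InnerProductSpace ℂ K]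
    (t : MultilinearMap ℂ H K) : Prop where
  inner_tmul : ∀ x y : ∀ o, H o, inner ℂ (t x) (t y) = ∏ o, inner ℂ (x o) (y o)
  dense_span : (Submodule.span ℂ (Set.range t)).topologicalClosure = ⊤

/-- The bounded operator `T` on the tensor product is `⨂ o, A o`.  Such a `T` is
unique, since elementary tensors span a dense subspace. -/
def IsTensorOperator {O : Type*} {H : O → Type*}
    [∀ o, NormedAddCommGroup (H o)] [∀ o, InnerProductSpace ℂ (H o)]
    {K : Type*} [NormedAddCommGroup K] [InnerProductSpace ℂ K]
    (t : MultilinearMap ℂ H K) (A : ∀ o, H o →L[ℂ] H o) (T : K →L[ℂ] K) : Prop :=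
  ∀ x : ∀ o, H o, T (t x) = t (fun o => A o (x o))

/-- Operators on the `k` clusters, completed by the identity on the purifying system `none`. -/
def withIdentity {k : ℕ} {H : Option (Fin k) → Type*}
    [∀ o, NormedAddCommGroup (H o)] [∀ o, InnerProductSpace ℂ (H o)]
    (A : ∀ j : Fin k, H (some j) →L[ℂ] H (some j)) : ∀ o, H o →L[ℂ] H o
  | none => ContinuousLinearMap.id ℂ (H none)
  | some j => A j

/-! ### Bell experiments with clusters -/

/-- Input strings, or outcome strings, of the parties in cluster `j`; party `i` belongs to
cluster `c i`. -/
abbrev ClusterBits {N k : ℕ} (c : Fin N → Fin k) (j : Fin k) : Type :=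
  {i : Fin N // c i = j} → Fin 2

/-- The part of the string `x` that belongs to cluster `j`. -/
def clusterPart {N k : ℕ} (c : Fin N → Fin k) (j : Fin k) (x : Fin N → Fin 2) :
    ClusterBits c j :=
  fun i => x i.1

/-- Hamming weight of a bit string. -/
def hammingWeight {I : Type*} [Fintype I] (x : I → Fin 2) : ℕ := ∑ i, (x i : ℕ)

/-- A quantum strategy for `N` parties grouped into `k` collaborating clusters: a Hilbert space
for each cluster (`H (some j)`), a purifying system (`H none`), a purification `ψ` of the shared
state, and for each input string of each cluster a joint measurement (POVM) on
the space of the cluster whose outcomes are the strings of outcomes of its parties. -/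
structure ClusterStrategy {N k : ℕ} (c : Fin N → Fin k) where
  H : Option (Fin k) → Type u
  [normH : ∀ o, NormedAddCommGroup (H o)]
  [innerH : ∀ o, InnerProductSpace ℂ (H o)]
  [completeH : ∀ o, CompleteSpace (H o)]
  K : Type v
  [normK : NormedAddCommGroup K]
  [innerK : InnerProductSpace ℂ K]
  [completeK : CompleteSpace K]
  tmul : MultilinearMap ℂ H K
  isTensor : IsHilbertTensorProduct tmul
  ψ : K
  norm_ψ : ‖ψ‖ = 1
  /-- `effect j x a` is the POVM element of outcome `a` for input `x`. -/
  effect : ∀ j : Fin k, ClusterBits c j → ClusterBits c j → (H (some j) →L[ℂ] H (some j))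
  effect_pos : ∀ j x a, (effect j x a).IsPositive
  effect_sum : ∀ j x, ∑ a, effect j x a = ContinuousLinearMap.id ℂ (H (some j))

attribute [instance] ClusterStrategy.normH ClusterStrategy.innerH ClusterStrategy.completeH
  ClusterStrategy.normK ClusterStrategy.innerK ClusterStrategy.completeK

namespace ClusterStrategy

variable {N k : ℕ} {c : Fin N → Fin k}

/-- The strategy is compatible with the correlations `p a x = p(a|x)` (Born rule). -/
def Realizes (S : ClusterStrategy.{u, v} c) (p : (Fin N → Fin 2) → (Fin N → Fin 2) → ℝ) :
    Prop :=
  ∀ a x : Fin N → Fin 2, ∃ T : S.K →L[ℂ] S.K,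
    IsTensorOperator S.tmul
      (withIdentity fun j => S.effect j (clusterPart c j x) (clusterPart c j a)) T ∧
    inner ℂ S.ψ (T S.ψ) = (p a x : ℂ)

/-- The global observable of cluster `j` for input `x`: outcome strings of even parity
count `+1`, those of odd parity `-1`. -/
def observable (S : ClusterStrategy.{u, v} c) (j : Fin k) (x : ClusterBits c j) :
    S.H (some j) →L[ℂ] S.H (some j) :=
  ∑ a : ClusterBits c j, ((-1 : ℂ) ^ hammingWeight a) • S.effect j x a

/-- The component, at the computational basis state `τ` of the ancillary qubits, of the image of
the elementary tensor of `x` under `⨂ j, V j`, where `V j` maps the space of cluster `j` into the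
tensor product of a qubit and that space (written as pairs of vectors), and the
purifying system is left alone. -/
def branch (S : ClusterStrategy.{u, v} c)
    (V : ∀ j : Fin k, S.H (some j) →ₗᵢ[ℂ] PiLp 2 (fun _ : Fin 2 => S.H (some j)))
    (τ : Fin k → Fin 2) (x : ∀ o, S.H o) : ∀ o, S.H o
  | none => x none
  | some j => V j (x (some j)) (τ j)

/-- `Λ = ⨂ j, V j`, identity on the purifying system.  The target is the tensor product of
`k` qubits and `K`, written as families of vectors of `K` indexed by computational basis states. -/
def IsTensorIsometry (S : ClusterStrategy.{u, v} c)
    (V : ∀ j : Fin k, S.H (some j) →ₗᵢ[ℂ] PiLp 2 (fun _ : Fin 2 => S.H (some j)))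
    (Λ : S.K →ₗᵢ[ℂ] PiLp 2 (fun _ : Fin k → Fin 2 => S.K)) : Prop :=
  ∀ (x : ∀ o, S.H o) (τ : Fin k → Fin 2), Λ (S.tmul x) τ = S.tmul (S.branch V τ x)

end ClusterStrategy

/-- The vector `Φ ⊗ ζ`, for a `k`-qubit vector `Φ`. -/
def qubitsTensor {k : ℕ} {K : Type*} [NormedAddCommGroup K] [InnerProductSpace ℂ K]
    (Φ : (Fin k → Fin 2) → ℂ) (ζ : K) : PiLp 2 (fun _ : Fin k → Fin 2 => K) :=
  WithLp.toLp 2 (fun τ => Φ τ • ζ)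

/-- The matrix of `⨂ j, B j` in the computational basis of `k` qubits. -/
def qubitOperator {k : ℕ} (B : Fin k → Matrix (Fin 2) (Fin 2) ℂ) :
    Matrix (Fin k → Fin 2) (Fin k → Fin 2) ℂ :=
  Matrix.of fun σ τ => ∏ j, B j (σ j) (τ j)

/-- The correlations `p` self-test the `k`-qubit state `Φ` and the target observables
`target j x`, in the network with clusters `c`. For every strategy compatible with `p` there
are isometries `V j`, local to the clusters, and a unit vector `ζ` such that
`(⨂ j, V j) ψ = Φ ⊗ ζ` and, for all inputs,
`(⨂ j, V j) (⨂ j, M j) ψ = ((⨂ j, target j) Φ) ⊗ ζ`, where `M j` is the joint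
observable of cluster `j`. -/
def SelfTests {N k : ℕ} (c : Fin N → Fin k)
    (p : (Fin N → Fin 2) → (Fin N → Fin 2) → ℝ)
    (Φ : (Fin k → Fin 2) → ℂ)
    (target : ∀ j : Fin k, ClusterBits c j → Matrix (Fin 2) (Fin 2) ℂ) : Prop :=
  ∀ S : ClusterStrategy.{u, v} c, S.Realizes p →
    ∃ (V : ∀ j : Fin k, S.H (some j) →ₗᵢ[ℂ] PiLp 2 (fun _ : Fin 2 => S.H (some j)))
      (Λ : S.K →ₗᵢ[ℂ] PiLp 2 (fun _ : Fin k → Fin 2 => S.K)) (ζ : S.K),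
      S.IsTensorIsometry V Λ ∧ ‖ζ‖ = 1 ∧
      Λ S.ψ = qubitsTensor Φ ζ ∧
      ∀ x : Fin N → Fin 2, ∃ M : S.K →L[ℂ] S.K,
        IsTensorOperator S.tmul
          (withIdentity fun j => S.observable j (clusterPart c j x)) M ∧
        Λ (M S.ψ) =
          qubitsTensor
            ((qubitOperator fun j => target j (clusterPart c j x)).mulVec Φ) ζ

/-! ### The Svetlichny expressions -/

/-- The coefficient `(-1) ^ (w (w ± 1) / 2)`; `s` is the sign `±`. -/
def svetlichnyCoeff (s : ℤˣ) (w : ℕ) : ℝ :=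
  (-1 : ℝ) ^ ((w : ℤ) * ((w : ℤ) + (s : ℤ)) / 2)

/-- The full correlator for input `x`: the sum of `(-1)^(a₁ + ⋯ + a_N) p(a|x)`. -/
def correlator {N : ℕ} (p : (Fin N → Fin 2) → (Fin N → Fin 2) → ℝ) (x : Fin N → Fin 2) : ℝ :=
  ∑ a : Fin N → Fin 2, (-1 : ℝ) ^ hammingWeight a * p a x

/-- The `N`-partite Svetlichny expression `S_N^±`. -/
def svetlichny {N : ℕ} (s : ℤˣ) (p : (Fin N → Fin 2) → (Fin N → Fin 2) → ℝ) : ℝ :=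
  ∑ x : Fin N → Fin 2, svetlichnyCoeff s (hammingWeight x) * correlator p x

/-! ### The self-tested state and observables -/

/-- The GHZ state `(|0…0⟩ + |1…1⟩) / √2` of `k` qubits. -/
def ghz (k : ℕ) (τ : Fin k → Fin 2) : ℂ :=
  if (∀ j, τ j = 0) ∨ (∀ j, τ j = 1) then ((1 / Real.sqrt 2 : ℝ) : ℂ) else 0

def pauliX : Matrix (Fin 2) (Fin 2) ℂ := !![0, 1; 1, 0]

def pauliY : Matrix (Fin 2) (Fin 2) ℂ := !![0, -Complex.I; Complex.I, 0]

/-- `σx, σy, -σx, -σy` for `w = 0, 1, 2, 3` modulo `4`. -/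
def pauliObservable (w : ℕ) : Matrix (Fin 2) (Fin 2) ℂ :=
  if w % 4 = 0 then pauliX
  else if w % 4 = 1 then pauliY
  else if w % 4 = 2 then -pauliX
  else -pauliY

/-- Target observable of cluster `j` for an input string of weight `w`, when
`S_N^s` attains `σ` times its maximum: a signed Pauli observable, with the
usual rotation by `π / 4` (and the overall sign `σ`) at the first cluster. -/
def targetObservable {k : ℕ} (s σ : ℤˣ) (j : Fin k) (w : ℕ) : Matrix (Fin 2) (Fin 2) ℂ :=
  if (j : ℕ) = 0 then
    (((σ : ℤ) : ℂ) * ((1 / Real.sqrt 2 : ℝ) : ℂ)) •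
      (pauliObservable w + ((s : ℤ) : ℂ) • pauliObservable (w + 1))
  else pauliObservable w

/-- The value of the correlator for input `x` in the reference experiment, where the clusters share
the GHZ state and measure the target observables. -/
def referenceCorrelator {N k : ℕ} (c : Fin N → Fin k) (s σ : ℤˣ) (x : Fin N → Fin 2) : ℂ :=
  dotProduct (star (ghz k))
    ((qubitOperator fun j =>
      targetObservable s σ j (hammingWeight (clusterPart c j x))).mulVec (ghz k))

end

/-! Write `C j` for the average over inputs `x` of `p j x • M j x`, where the unit phases `p j x`
are `I ^ w`, with an extra factor `σ (1 + s I) / √2` at the first cluster. The product of the phases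
over the clusters has real part `σ / √2` times the Svetlichny coefficient, so `Re ⟪ψ, (⨂ C j) ψ⟫`
is, up to scale, the Svetlichny value, and the bound becomes `Re ⟪ψ, (⨂ C j) ψ⟫ ≤ 1/2`.

For the bound, one cluster is cut from the rest: `C` is its average, with phases `v x`, and `P` is
the product of the other averages. Fourth roots of unity give `‖P ψ‖² + ‖P⋆ ψ‖² ≤ 1`
(`IsBalancedPhase.norm_sq_sum_add_le`). Expanding `‖M x ψ - (v x P ψ + conj (v x) P⋆ ψ)‖²` and
summing over `x` then gives `sum_norm_sub_sq_le`.

At equality every square vanishes, so `M x ψ = v x P ψ + conj (v x) P⋆ ψ` and `M x (M x ψ) = ψ`.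
Averaging these against powers of the phases yields `C⋆ ψ = P ψ`, `C ψ = P⋆ ψ`, `(C C⋆ + C⋆ C) ψ =
ψ` and `C² ψ + κ C⋆² ψ = 0`, with `κ` the common fourth power of the phases. The last relation on
both sides of the cut, together with `∏ κ j = -1`, forces `C² ψ = 0`. Thus each `C j` acts on the
state like a qubit ladder operator (`GHZRelations`).

These relations split `ψ` into `ζ₀ = (⨂ C j) ψ` and the orthogonal vector `(⨂ C j⋆) ψ`. The dilation
`h ↦ (√(1 - C j⋆ C j) h, C j h)` is a local isometry; the product isometry sends the two halves to
`|0…0⟩ ⊗ ζ₀` and `|1…1⟩ ⊗ ζ₀` (`GHZRelations.exists_isometry`). Products of observables act on `ψ`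
only through these halves, which gives the second self-testing identity. -/

/-! ### Operators and isometries on Hilbert tensor products -/

/-- A map with the same Gram matrix as a total family of vectors is induced by an isometry. -/
theorem exists_linearIsometry_of_inner_eq {X K L : Type*}
    [NormedAddCommGroup K] [InnerProductSpace ℂ K]
    [NormedAddCommGroup L] [InnerProductSpace ℂ L] [CompleteSpace L]
    (t : X → K) (f : X → L) (ht : (Submodule.span ℂ (Set.range t)).topologicalClosure = ⊤)
    (h : ∀ x y, inner ℂ (f x) (f y) = inner ℂ (t x) (t y)) :
    ∃ Λ : K →ₗᵢ[ℂ] L, ∀ x, Λ (t x) = f x := by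
  set e : (X →₀ ℂ) →ₗ[ℂ] K := Finsupp.linearCombination ℂ t with he
  set g : (X →₀ ℂ) →ₗ[ℂ] L := Finsupp.linearCombination ℂ f with hg
  have hdense : DenseRange e := by
    have h1 : Dense ((Submodule.span ℂ (Set.range t) : Submodule ℂ K) : Set K) := by
      rw [← Submodule.dense_iff_topologicalClosure_eq_top] at ht
      exact ht
    rw [← Finsupp.range_linearCombination] at h1
    simpa [DenseRange] using! h1
  have hinner : ∀ a, inner ℂ (g a) (g a) = inner ℂ (e a) (e a) := fun a => by
    simp only [he, hg, Finsupp.linearCombination_apply, Finsupp.sum, sum_inner, inner_sum,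
      inner_smul_left, inner_smul_right, h]
  have hnorm : ∀ a, ‖g a‖ = ‖e a‖ := fun a => by
    rw [@norm_eq_sqrt_re_inner ℂ, @norm_eq_sqrt_re_inner ℂ _ _ _ _ (e a), hinner]
  have hb : ∀ a, ‖g a‖ ≤ 1 * ‖e a‖ := fun a => by rw [hnorm, one_mul]
  have hext : ∀ a, g.extendOfNorm e (e a) = g a :=
    LinearMap.extendOfNorm_eq hdense ⟨1, hb⟩
  refine ⟨⟨(g.extendOfNorm e).toLinearMap, ?_⟩, fun x => ?_⟩
  · refine hdense.induction ?_ (isClosed_eq (by simp only [ContinuousLinearMap.coe_coe]; fun_prop)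
      (by fun_prop))
    rintro _ ⟨a, rfl⟩
    exact (congrArg norm (hext a)).trans (hnorm a)
  · have := hext (Finsupp.single x 1)
    simpa [he, hg] using this

section Contraction

variable {H : Type*} [NormedAddCommGroup H] [InnerProductSpace ℂ H] [CompleteSpace H]

/-- The defect operator of a contraction has a fourth root. -/
theorem exists_defect_root (C : H →L[ℂ] H) (hC : ‖C‖ ≤ 1) :
    ∃ q : H →L[ℂ] H, IsSelfAdjoint q ∧ (q * q) * (q * q) = 1 - star C * C := by
  have hpos : 0 ≤ 1 - star C * C := by
    have h := CStarAlgebra.norm_le_one_iff_of_nonneg (star C * C) (star_mul_self_nonneg C)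
    refine sub_nonneg.2 (h.1 ?_)
    rw [CStarRing.norm_star_mul_self]
    exact mul_le_one₀ hC (norm_nonneg _) hC
  -- The second square root exhibits the defect operator `q * q` as the square of a self-adjoint
  -- operator, a form of positivity that passes to the global space by multiplicativity alone.
  refine ⟨CFC.sqrt (CFC.sqrt (1 - star C * C)), (CFC.sqrt_nonneg _).isSelfAdjoint, ?_⟩
  rw [CFC.sqrt_mul_sqrt_self _ (CFC.sqrt_nonneg _), CFC.sqrt_mul_sqrt_self _ hpos]

/-- The isometric dilation `h ↦ (r h, C h)` of a contraction `C` with defect operator `r`. -/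
theorem exists_dilation (C r : H →L[ℂ] H) (hr : IsSelfAdjoint r) (h : r * r = 1 - star C * C) :
    ∃ V : H →ₗᵢ[ℂ] PiLp 2 (fun _ : Fin 2 => H), ∀ x, V x 0 = r x ∧ V x 1 = C x := by
  refine ⟨⟨(WithLp.linearEquiv 2 ℂ (Fin 2 → H)).symm.toLinearMap ∘ₗ
    LinearMap.pi ![r.toLinearMap, C.toLinearMap], fun x => ?_⟩, fun x => ⟨rfl, rfl⟩⟩
  have h1 : (inner ℂ (r x) (r x) : ℂ) = inner ℂ x x - inner ℂ (C x) (C x) := by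
    have h2 := congrArg (fun T : H →L[ℂ] H => (inner ℂ x (T x) : ℂ)) h
    simp only [mul_apply_eq_comp, sub_apply, inner_sub_right,
      one_apply_eq_self, ContinuousLinearMap.star_eq_adjoint,
      ContinuousLinearMap.adjoint_inner_right] at h2
    rw [← h2, ← ContinuousLinearMap.adjoint_inner_right, ← ContinuousLinearMap.star_eq_adjoint,
      hr.star_eq]
  have h3 : ‖r x‖ ^ 2 + ‖C x‖ ^ 2 = ‖x‖ ^ 2 := by
    simp only [inner_self_eq_norm_sq_to_K] at h1
    have h4 : ((‖r x‖ ^ 2 : ℝ) : ℂ) = ((‖x‖ ^ 2 - ‖C x‖ ^ 2 : ℝ) : ℂ) := by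
      push_cast; exact h1
    have := Complex.ofReal_injective h4
    linarith
  rw [PiLp.norm_eq_of_L2, Fin.sum_univ_two]
  change Real.sqrt (‖r x‖ ^ 2 + ‖C x‖ ^ 2) = ‖x‖
  rw [h3, Real.sqrt_sq (norm_nonneg _)]

end Contraction

namespace ClusterStrategy

variable {N k : ℕ} {c : Fin N → Fin k} (S : ClusterStrategy.{u, v} c)

/-- The sum over `τ` of products of branch inner products factors into a product over clusters of
sums over one bit. Each such sum is an inner product preserved by `V j`, so the Gram matrices of
elementary tensors agree. -/
theorem exists_isTensorIsometry
    (V : ∀ j : Fin k, S.H (some j) →ₗᵢ[ℂ] PiLp 2 (fun _ : Fin 2 => S.H (some j))) :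
    ∃ Λ : S.K →ₗᵢ[ℂ] PiLp 2 (fun _ : Fin k → Fin 2 => S.K), S.IsTensorIsometry V Λ := by
  obtain ⟨Λ, hΛ⟩ := exists_linearIsometry_of_inner_eq (fun x => S.tmul x)
    (fun x => (WithLp.toLp 2 (fun τ => S.tmul (S.branch V τ x)) :
      PiLp 2 (fun _ : Fin k → Fin 2 => S.K))) S.isTensor.dense_span (fun x y => by
      simp only [PiLp.inner_apply, S.isTensor.inner_tmul, Fintype.prod_option, branch]
      rw [← Finset.mul_sum]
      have := Finset.prod_univ_sum (fun _ : Fin k => (Finset.univ : Finset (Fin 2)))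
        (fun j b => (inner ℂ (V j (x (some j)) b) (V j (y (some j)) b) : ℂ))
      rw [Fintype.piFinset_univ] at this
      rw [← this]
      congr 1
      refine Finset.prod_congr rfl fun j _ => ?_
      rw [← (V j).inner_map_map, PiLp.inner_apply])
  exact ⟨Λ, fun x τ => by rw [hΛ]⟩

theorem ext_of_tmul {A B : S.K →L[ℂ] S.K} (h : ∀ x, A (S.tmul x) = B (S.tmul x)) : A = B := by
  have hd : Dense ((Submodule.span ℂ (Set.range S.tmul) : Submodule ℂ S.K) : Set S.K) :=
    Submodule.dense_iff_topologicalClosure_eq_top.2 S.isTensor.dense_span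
  refine ContinuousLinearMap.ext_on hd ?_
  rintro _ ⟨x, rfl⟩
  exact h x

/-- Families of operators on the clusters. -/
abbrev LocalOps : Type u := ∀ j : Fin k, S.H (some j) →L[ℂ] S.H (some j)

/-- Each contraction is a component of an isometric dilation. Their product is a component of the
tensor isometry, hence again a contraction. -/
theorem exists_isTensorOperator_of_contraction (A : S.LocalOps) (hA : ∀ j, ‖A j‖ ≤ 1) :
    ∃ T : S.K →L[ℂ] S.K, IsTensorOperator S.tmul (withIdentity A) T ∧ ∀ φ, ‖T φ‖ ≤ ‖φ‖ := by
  choose q hq hq2 using fun j => exists_defect_root (A j) (hA j)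
  choose V hV using fun j => exists_dilation (A j) (q j * q j)
    (by rw [IsSelfAdjoint, star_mul, (hq j).star_eq]) (hq2 j)
  obtain ⟨Λ, hΛ⟩ := S.exists_isTensorIsometry V
  refine ⟨(PiLp.proj 2 (fun _ : Fin k → Fin 2 => S.K) (fun _ => 1) :
      PiLp 2 (fun _ : Fin k → Fin 2 => S.K) →L[ℂ] S.K).comp Λ.toContinuousLinearMap,
    fun x => ?_, fun φ => ?_⟩
  · change Λ (S.tmul x) (fun _ => 1) = _
    rw [hΛ]
    congr 1
    funext o
    cases o with
    | none => rfl
    | some j => exact (hV j _).2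
  · change ‖Λ φ (fun _ => 1)‖ ≤ ‖φ‖
    rw [← Λ.norm_map φ]
    exact PiLp.norm_apply_le (Λ φ) _

theorem tmul_smul_some (a : Fin k → ℂ) (x y : ∀ o, S.H o) (h0 : y none = x none)
    (h1 : ∀ j, y (some j) = a j • x (some j)) : S.tmul y = (∏ j, a j) • S.tmul x := by
  have : y = fun o => (o.elim (1 : ℂ) a) • x o := by
    funext o
    cases o with
    | none => simp [h0]
    | some j => simp [h1]
  rw [this, MultilinearMap.map_smul_univ]
  simp [Fintype.prod_option]

theorem exists_isTensorOperator (A : S.LocalOps) :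
    ∃ T : S.K →L[ℂ] S.K, IsTensorOperator S.tmul (withIdentity A) T := by
  have hne : ∀ j, ((‖A j‖ + 1 : ℝ) : ℂ) ≠ 0 := fun j => by
    exact_mod_cast (by positivity : (‖A j‖ + 1 : ℝ) ≠ 0)
  obtain ⟨T, hT, -⟩ := S.exists_isTensorOperator_of_contraction
    (fun j => ((‖A j‖ + 1 : ℝ) : ℂ)⁻¹ • A j) (fun j => by
      rw [norm_smul, norm_inv, Complex.norm_real, Real.norm_of_nonneg (by positivity),
        inv_mul_le_iff₀ (by positivity)]
      linarith)
  refine ⟨(∏ j, ((‖A j‖ + 1 : ℝ) : ℂ)) • T, fun x => ?_⟩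
  rw [smul_apply, hT]
  refine (S.tmul_smul_some (fun j => ((‖A j‖ + 1 : ℝ) : ℂ))
    (fun o => withIdentity (fun j => ((‖A j‖ + 1 : ℝ) : ℂ)⁻¹ • A j) o (x o))
    (fun o => withIdentity A o (x o)) rfl fun j => ?_).symm
  simp only [withIdentity, smul_apply]
  rw [smul_smul, mul_inv_cancel₀ (hne j), one_smul]

/-- The operator `⨂ j, A j` on the global space, with the identity on the purifying system. -/
noncomputable def tensorOp (A : S.LocalOps) : S.K →L[ℂ] S.K := (S.exists_isTensorOperator A).choose

theorem isTensorOperator_tensorOp (A : S.LocalOps) :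
    IsTensorOperator S.tmul (withIdentity A) (S.tensorOp A) :=
  (S.exists_isTensorOperator A).choose_spec

theorem tensorOp_tmul (A : S.LocalOps) (x : ∀ o, S.H o) :
    S.tensorOp A (S.tmul x) = S.tmul (fun o => withIdentity A o (x o)) :=
  S.isTensorOperator_tensorOp A x

theorem eq_tensorOp {A : S.LocalOps} {T : S.K →L[ℂ] S.K}
    (h : IsTensorOperator S.tmul (withIdentity A) T) : T = S.tensorOp A :=
  S.ext_of_tmul fun x => by rw [h, S.tensorOp_tmul]

theorem norm_tensorOp_apply_le (A : S.LocalOps) (hA : ∀ j, ‖A j‖ ≤ 1) (φ : S.K) :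
    ‖S.tensorOp A φ‖ ≤ ‖φ‖ := by
  obtain ⟨T, hT, hn⟩ := S.exists_isTensorOperator_of_contraction A hA
  rw [← S.eq_tensorOp hT]
  exact hn φ

theorem tensorOp_one : S.tensorOp 1 = 1 :=
  (S.eq_tensorOp fun x => by
    rw [one_apply_eq_self]
    congr 1
    funext o
    cases o <;> rfl).symm

theorem tensorOp_mul (A B : S.LocalOps) :
    S.tensorOp (A * B) = S.tensorOp A * S.tensorOp B :=
  (S.eq_tensorOp fun x => by
    rw [mul_apply_eq_comp, S.tensorOp_tmul, S.tensorOp_tmul]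
    congr 1
    funext o
    cases o <;> rfl).symm

/-- Both sides have the same inner products with elementary tensors, where adjoints can be moved
factor by factor; density does the rest. -/
theorem tensorOp_star (A : S.LocalOps) : S.tensorOp (star A) = star (S.tensorOp A) := by
  refine S.ext_of_tmul fun x => ?_
  have hd : Dense ((Submodule.span ℂ (Set.range S.tmul) : Submodule ℂ S.K) : Set S.K) :=
    Submodule.dense_iff_topologicalClosure_eq_top.2 S.isTensor.dense_span
  have key : ∀ y ∈ Submodule.span ℂ (Set.range S.tmul),
      inner ℂ y (S.tensorOp (star A) (S.tmul x) - star (S.tensorOp A) (S.tmul x)) = 0 := by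
    intro y hy
    induction hy using Submodule.span_induction with
    | mem y hy =>
      obtain ⟨y, rfl⟩ := hy
      rw [inner_sub_right, ContinuousLinearMap.star_eq_adjoint,
        ContinuousLinearMap.adjoint_inner_right, S.tensorOp_tmul, S.tensorOp_tmul,
        S.isTensor.inner_tmul, S.isTensor.inner_tmul, sub_eq_zero, Fintype.prod_option,
        Fintype.prod_option]
      congr 1
      refine Finset.prod_congr rfl fun j _ => ?_
      exact ContinuousLinearMap.adjoint_inner_right (A j) _ _
    | zero => simp
    | add y z _ _ hy hz => rw [inner_add_left, hy, hz, add_zero]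
    | smul a y _ hy => rw [inner_smul_left, hy, mul_zero]
  exact sub_eq_zero.1 (hd.eq_zero_of_mem_orthogonal ((Submodule.mem_orthogonal _ _).2 key))

theorem tensorOp_update_tmul [DecidableEq (Fin k)] (A : S.LocalOps) (i : Fin k)
    (X : S.H (some i) →L[ℂ] S.H (some i)) (x : ∀ o, S.H o) :
    S.tensorOp (Function.update A i X) (S.tmul x) =
      S.tmul (Function.update (fun o => withIdentity A o (x o)) (some i) (X (x (some i)))) := by
  rw [S.tensorOp_tmul]
  congr 1
  funext o
  cases o with
  | none => simp [withIdentity]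
  | some j =>
    by_cases h : j = i
    · subst h
      simp [withIdentity]
    · rw [Function.update_of_ne (by simpa using h)]
      simp [withIdentity, Function.update_of_ne h]

/-- `tensorOp` as a multilinear map. -/
noncomputable def tensorOpMultilinear :
    MultilinearMap ℂ (fun j : Fin k => S.H (some j) →L[ℂ] S.H (some j)) (S.K →L[ℂ] S.K) where
  toFun := S.tensorOp
  map_update_add' m i a b := by
    refine S.ext_of_tmul fun x => ?_
    rw [add_apply, S.tensorOp_update_tmul, S.tensorOp_update_tmul, S.tensorOp_update_tmul,
      add_apply, MultilinearMap.map_update_add]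
  map_update_smul' m i a b := by
    refine S.ext_of_tmul fun x => ?_
    rw [smul_apply, S.tensorOp_update_tmul, S.tensorOp_update_tmul, smul_apply,
      MultilinearMap.map_update_smul]

theorem tensorOpMultilinear_apply (A : S.LocalOps) : S.tensorOpMultilinear A = S.tensorOp A := rfl

end ClusterStrategy

/-! ### A sum-of-squares bound for a pair of commuting families of observables -/

section Bipartite

variable {K : Type*} [NormedAddCommGroup K] [InnerProductSpace ℂ K]

/-- The average of a family of operators with phases. -/
noncomputable def phaseAverage {I : Type*} [Fintype I] (v : I → ℂ) (M : I → K →L[ℂ] K) :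
    K →L[ℂ] K :=
  ((Fintype.card I : ℂ)⁻¹) • ∑ x, v x • M x

theorem sum_phase_smul {I : Type*} [Fintype I] [Nonempty I] (v : I → ℂ) (M : I → K →L[ℂ] K) :
    ∑ x, v x • M x = (Fintype.card I : ℂ) • phaseAverage v M := by
  rw [phaseAverage, smul_smul, mul_inv_cancel₀ (by simp), one_smul]

/-- Phases whose ratios are fourth roots of unity and whose squares cancel. -/
structure IsBalancedPhase {I : Type*} [Fintype I] (v : I → ℂ) (κ : ℂ) : Prop where
  norm_eq : ∀ x, ‖v x‖ = 1
  pow_four : ∀ x, v x ^ 4 = κ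
  sum_sq : ∑ x, v x ^ 2 = 0

/-- Such a `d` is `±1` or `±I`, and both sides are then `2` or `0`. This linearizes the absolute
value, so that sums over phases can be evaluated. -/
theorem norm_phase_add_conj {d : ℂ} (hd : ‖d‖ = 1) (h4 : d ^ 4 = 1) :
    ‖d + star d‖ = 1 + (d ^ 2).re := by
  have h2 : (d ^ 2 - 1) * (d ^ 2 + 1) = 0 := by linear_combination h4
  have hre : d.re ^ 2 + d.im ^ 2 = 1 := by
    have := Complex.sq_norm d
    rw [hd, Complex.normSq_apply] at this
    linarith
  have e1 : d + star d = ((2 * d.re : ℝ) : ℂ) := by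
    apply Complex.ext <;> simp; ring
  have e2 : (d ^ 2).re = d.re ^ 2 - d.im ^ 2 := by rw [sq, Complex.mul_re]; ring
  rw [e1, Complex.norm_real, e2, Real.norm_eq_abs]
  rcases mul_eq_zero.1 h2 with h | h
  · have : (d ^ 2).re = 1 := by rw [sub_eq_zero.1 h]; simp
    rw [e2] at this
    have h1 : d.re ^ 2 = 1 := by linarith
    rcases sq_eq_sq_iff_eq_or_eq_neg.1 (h1.trans (one_pow 2).symm) with h | h <;>
      rw [h] <;> norm_num <;> linarith
  · have : (d ^ 2).re = -1 := by rw [eq_neg_of_add_eq_zero_left h]; simp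
    rw [e2] at this
    have h1 : d.re = 0 := by nlinarith
    rw [h1] at this ⊢
    norm_num
    linarith

theorem IsBalancedPhase.star_mul_self {I : Type*} [Fintype I] {v : I → ℂ} {κ : ℂ}
    (hv : IsBalancedPhase v κ) (x : I) : star (v x) * v x = 1 := by
  have h := Complex.conj_mul' (v x)
  rw [hv.norm_eq] at h
  simpa using h

theorem IsBalancedPhase.sum_star_sq {I : Type*} [Fintype I] {v : I → ℂ} {κ : ℂ}
    (hv : IsBalancedPhase v κ) : ∑ x, star (v x) ^ 2 = 0 := by
  have := congrArg star hv.sum_sq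
  simpa only [star_sum, star_pow, star_zero] using this

/-- The double sum has coefficients `d + conj d`, where `d = conj (q y) * q z` is a fourth root of
unity. Their absolute values `1 + Re (d²)` add up to `(card J)²`, since the squares of the phases
sum to zero. Bounding without the conjugate sum would lose a factor of two. -/
theorem IsBalancedPhase.norm_sq_sum_add_le {J : Type*} [Fintype J] {q : J → ℂ} {κ : ℂ}
    (hq : IsBalancedPhase q κ) {w : J → K} (hw : ∀ y, ‖w y‖ ≤ 1) :
    ‖∑ y, q y • w y‖ ^ 2 + ‖∑ y, star (q y) • w y‖ ^ 2 ≤ (Fintype.card J : ℝ) ^ 2 := by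
  have hterm : ∀ y z, ‖((star (q y) * q z) + star (star (q y) * q z)) * (inner ℂ (w y) (w z) : ℂ)‖
      ≤ 1 + (star (q y) ^ 2 * q z ^ 2).re := fun y z => by
    rw [norm_mul, norm_phase_add_conj (by simp [hq.norm_eq]) (by
      rw [mul_pow, hq.pow_four, ← star_pow, hq.pow_four, ← hq.pow_four y, ← mul_one (1 : ℂ),
        star_pow, ← mul_pow, hq.star_mul_self]; simp), mul_pow]
    refine mul_le_of_le_one_right ?_ ?_
    · have h1 : ‖star (q y) ^ 2 * q z ^ 2‖ = 1 := by simp [hq.norm_eq]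
      have h2 := (abs_le.1 (Complex.abs_re_le_norm (star (q y) ^ 2 * q z ^ 2))).1
      rw [h1] at h2
      linarith
    · exact (norm_inner_le_norm _ _).trans (mul_le_one₀ (hw y) (norm_nonneg _) (hw z))
  have hexp : ((‖∑ y, q y • w y‖ ^ 2 + ‖∑ y, star (q y) • w y‖ ^ 2 : ℝ) : ℂ) =
      ∑ y, ∑ z, ((star (q y) * q z) + star (star (q y) * q z)) * (inner ℂ (w y) (w z) : ℂ) := by
    push_cast
    have h1 := inner_self_eq_norm_sq_to_K (𝕜 := ℂ) (∑ y, q y • w y)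
    have h2 := inner_self_eq_norm_sq_to_K (𝕜 := ℂ) (∑ y, star (q y) • w y)
    simp only [Complex.coe_algebraMap] at h1 h2
    rw [← h1, ← h2]
    simp only [sum_inner, inner_sum, inner_smul_left, inner_smul_right, Finset.mul_sum,
      ← Finset.sum_add_distrib]
    rw [Finset.sum_comm]
    refine Finset.sum_congr rfl fun y _ => Finset.sum_congr rfl fun z _ => ?_
    simp only [star_mul', star_star, starRingEnd_apply]
    ring
  have hsum : ∑ y, ∑ z, (1 + (star (q y) ^ 2 * q z ^ 2).re) = (Fintype.card J : ℝ) ^ 2 := by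
    simp only [Finset.sum_add_distrib, ← Complex.re_sum, ← Finset.mul_sum, hq.sum_sq]
    simp [sq]
  calc _ = ‖((‖∑ y, q y • w y‖ ^ 2 + ‖∑ y, star (q y) • w y‖ ^ 2 : ℝ) : ℂ)‖ := by
        rw [Complex.norm_real, Real.norm_of_nonneg (by positivity)]
    _ ≤ ∑ y, ∑ z, (1 + (star (q y) ^ 2 * q z ^ 2).re) := by
        rw [hexp]
        exact (norm_sum_le _ _).trans (Finset.sum_le_sum fun y _ =>
          (norm_sum_le _ _).trans (Finset.sum_le_sum fun z _ => hterm y z))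
    _ = _ := hsum

theorem norm_sq_phaseAverage_add_le {J : Type*} [Fintype J] [Nonempty J] {q : J → ℂ} {κ : ℂ}
    (hq : IsBalancedPhase q κ) {B : J → K →L[ℂ] K} {ψ : K} (hB : ∀ y, ‖B y ψ‖ ≤ 1) :
    ‖phaseAverage q B ψ‖ ^ 2 + ‖phaseAverage (star q) B ψ‖ ^ 2 ≤ 1 := by
  have h := hq.norm_sq_sum_add_le hB
  have hc : (0 : ℝ) < Fintype.card J := by exact_mod_cast Fintype.card_pos
  simp only [phaseAverage, smul_apply, sum_apply, norm_smul, mul_pow, norm_inv,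
    Complex.norm_natCast, Pi.star_apply]
  rw [← mul_add, inv_pow, inv_mul_le_iff₀ (by positivity), mul_one]
  exact h

variable [CompleteSpace K]

theorem IsSelfAdjoint.inner_map_left {A : K →L[ℂ] K} (hA : IsSelfAdjoint A) (x y : K) :
    (inner ℂ (A x) y : ℂ) = inner ℂ x (A y) := by
  rw [← ContinuousLinearMap.adjoint_inner_right, ← ContinuousLinearMap.star_eq_adjoint, hA.star_eq]

theorem inner_star_apply_left (A : K →L[ℂ] K) (x y : K) :
    (inner ℂ (star A x) y : ℂ) = inner ℂ x (A y) := by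
  rw [ContinuousLinearMap.star_eq_adjoint, ContinuousLinearMap.adjoint_inner_left]

/-- A self-adjoint contraction preserving the norm of a vector squares to the identity on it. -/
theorem IsSelfAdjoint.apply_apply_eq_self {A : K →L[ℂ] K} (hA : IsSelfAdjoint A) {ψ : K}
    (h1 : ‖A (A ψ)‖ ≤ ‖ψ‖) (h2 : ‖A ψ‖ = ‖ψ‖) : A (A ψ) = ψ := by
  have h3 : RCLike.re (inner ℂ (A (A ψ)) ψ : ℂ) = ‖ψ‖ ^ 2 := by
    rw [hA.inner_map_left, ← h2, inner_self_eq_norm_sq]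
  have h4 := norm_sub_sq (𝕜 := ℂ) (A (A ψ)) ψ
  rw [h3] at h4
  have h5 : ‖A (A ψ)‖ ^ 2 ≤ ‖ψ‖ ^ 2 := by gcongr
  have h6 : ‖A (A ψ) - ψ‖ ^ 2 ≤ 0 := by linarith
  exact sub_eq_zero.1 (norm_eq_zero.1 (pow_eq_zero_iff two_ne_zero |>.1
    (le_antisymm h6 (sq_nonneg _))))

theorem star_phaseAverage {I : Type*} [Fintype I] (v : I → ℂ) (M : I → K →L[ℂ] K)
    (hM : ∀ x, IsSelfAdjoint (M x)) : star (phaseAverage v M) = phaseAverage (star v) M := by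
  simp only [phaseAverage, star_smul, star_sum, (hM _).star_eq, Pi.star_apply,
    star_inv₀, star_natCast]

/-- The sum-of-squares decomposition behind the bound. -/
theorem sum_norm_sub_sq_le {I : Type*} [Fintype I] [Nonempty I] {v : I → ℂ} {κ : ℂ}
    (hv : IsBalancedPhase v κ) {M : I → K →L[ℂ] K} (hM : ∀ x, IsSelfAdjoint (M x))
    {P : K →L[ℂ] K} (hMP : ∀ x, Commute (M x) P) {ψ : K}
    (hP : ‖P ψ‖ ^ 2 + ‖star P ψ‖ ^ 2 ≤ 1) :
    ∑ x, (‖M x ψ - (v x • P ψ + star (v x) • star P ψ)‖ ^ 2 + (1 - ‖M x ψ‖ ^ 2)) ≤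
      Fintype.card I * (2 - 4 * (inner ℂ ψ (phaseAverage v M (P ψ)) : ℂ).re) := by
  -- Commutation of `M x` with `P` makes the two halves of the cross term complex conjugates of each
  -- other.
  have hcross : ∀ x, (inner ℂ (M x ψ) (v x • P ψ + star (v x) • star P ψ) : ℂ).re =
      2 * (inner ℂ ψ ((v x • M x) (P ψ)) : ℂ).re := fun x => by
    have h1 : (inner ℂ (M x ψ) (v x • P ψ) : ℂ) = inner ℂ ψ ((v x • M x) (P ψ)) := by
      rw [inner_smul_right, (hM x).inner_map_left, smul_apply, inner_smul_right]
    have h2 : (inner ℂ (M x ψ) (star (v x) • star P ψ) : ℂ) =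
        star (inner ℂ ψ ((v x • M x) (P ψ)) : ℂ) := by
      rw [inner_smul_right, ← inner_conj_symm, inner_star_apply_left, smul_apply,
        inner_smul_right, star_mul']
      have : M x (P ψ) = P (M x ψ) := congrArg (fun T : K →L[ℂ] K => T ψ) (hMP x)
      rw [this]
      rfl
    rw [inner_add_right, h1, h2, Complex.add_re, Complex.star_def, Complex.conj_re]
    ring
  have hsq : ∀ x, ‖v x • P ψ + star (v x) • star P ψ‖ ^ 2 =
      ‖P ψ‖ ^ 2 + ‖star P ψ‖ ^ 2 + 2 * (star (v x) ^ 2 * inner ℂ (P ψ) (star P ψ) : ℂ).re :=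
    fun x => by
    rw [norm_add_sq (𝕜 := ℂ), norm_smul, norm_smul, norm_star, hv.norm_eq, inner_smul_left,
      inner_smul_right, ← mul_assoc]
    simp only [starRingEnd_apply, one_mul, RCLike.re_eq_complex_re, sq]
    ring
  have hx : ∀ x, ‖M x ψ - (v x • P ψ + star (v x) • star P ψ)‖ ^ 2 + (1 - ‖M x ψ‖ ^ 2) =
      (1 + (‖P ψ‖ ^ 2 + ‖star P ψ‖ ^ 2)) +
        2 * (star (v x) ^ 2 * inner ℂ (P ψ) (star P ψ) : ℂ).re -
        4 * (inner ℂ ψ ((v x • M x) (P ψ)) : ℂ).re := fun x => by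
    rw [norm_sub_sq (𝕜 := ℂ), hsq, RCLike.re_eq_complex_re, hcross]
    ring
  have hav : ∑ x, (inner ℂ ψ ((v x • M x) (P ψ)) : ℂ).re =
      Fintype.card I * (inner ℂ ψ (phaseAverage v M (P ψ)) : ℂ).re := by
    rw [← Complex.re_sum, ← inner_sum, ← sum_apply, sum_phase_smul, smul_apply, inner_smul_right]
    simp
  -- The interference terms carry the factor `conj (v x)²` and cancel in the sum; the hypothesis on
  -- `P` bounds what remains.
  simp only [hx, Finset.sum_sub_distrib, Finset.sum_add_distrib, ← Finset.mul_sum, hav,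
    ← Complex.re_sum, ← Finset.sum_mul, hv.sum_star_sq]
  simp only [Finset.sum_const, Finset.card_univ, nsmul_eq_mul, zero_mul, Complex.zero_re]
  have hc : (0 : ℝ) ≤ Fintype.card I := by positivity
  nlinarith

theorem re_inner_phaseAverage_le {I : Type*} [Fintype I] [Nonempty I] {v : I → ℂ} {κ : ℂ}
    (hv : IsBalancedPhase v κ) {M : I → K →L[ℂ] K} (hM : ∀ x, IsSelfAdjoint (M x))
    {P : K →L[ℂ] K} (hMP : ∀ x, Commute (M x) P) {ψ : K} (hMψ : ∀ x, ‖M x ψ‖ ≤ 1)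
    (hP : ‖P ψ‖ ^ 2 + ‖star P ψ‖ ^ 2 ≤ 1) :
    (inner ℂ ψ (phaseAverage v M (P ψ)) : ℂ).re ≤ 1 / 2 := by
  have h := sum_norm_sub_sq_le hv hM hMP hP
  have h0 : 0 ≤ ∑ x, (‖M x ψ - (v x • P ψ + star (v x) • star P ψ)‖ ^ 2 + (1 - ‖M x ψ‖ ^ 2)) :=
    Finset.sum_nonneg fun x _ => add_nonneg (sq_nonneg _)
      (sub_nonneg.2 (pow_le_one₀ (norm_nonneg _) (hMψ x)))
  have hc : (0 : ℝ) < Fintype.card I := by exact_mod_cast Fintype.card_pos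
  have := nonneg_of_mul_nonneg_right (h0.trans h) hc
  linarith

theorem apply_eq_of_re_inner_eq {I : Type*} [Fintype I] [Nonempty I] {v : I → ℂ} {κ : ℂ}
    (hv : IsBalancedPhase v κ) {M : I → K →L[ℂ] K} (hM : ∀ x, IsSelfAdjoint (M x))
    {P : K →L[ℂ] K} (hMP : ∀ x, Commute (M x) P) {ψ : K} (hMψ : ∀ x, ‖M x ψ‖ ≤ 1)
    (hP : ‖P ψ‖ ^ 2 + ‖star P ψ‖ ^ 2 ≤ 1)
    (heq : (inner ℂ ψ (phaseAverage v M (P ψ)) : ℂ).re = 1 / 2) (x : I) :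
    M x ψ = v x • P ψ + star (v x) • star P ψ ∧ ‖M x ψ‖ = 1 := by
  have h := sum_norm_sub_sq_le hv hM hMP hP
  rw [heq] at h
  have hn : ∀ x, 0 ≤ 1 - ‖M x ψ‖ ^ 2 := fun x =>
    sub_nonneg.2 (pow_le_one₀ (norm_nonneg _) (hMψ x))
  have h0 := Finset.single_le_sum
    (f := fun x => ‖M x ψ - (v x • P ψ + star (v x) • star P ψ)‖ ^ 2 + (1 - ‖M x ψ‖ ^ 2))
    (fun x _ => add_nonneg (sq_nonneg _) (hn x)) (Finset.mem_univ x)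
  norm_num at h
  have h1 := h0.trans h
  have h2 := hn x
  have h3 := sq_nonneg ‖M x ψ - (v x • P ψ + star (v x) • star P ψ)‖
  have h4 : ‖M x ψ - (v x • P ψ + star (v x) • star P ψ)‖ ^ 2 = 0 := by linarith
  have h5 : ‖M x ψ‖ ^ 2 = 1 := by linarith
  exact ⟨sub_eq_zero.1 (norm_eq_zero.1 (pow_eq_zero_iff two_ne_zero |>.1 h4)),
    (pow_eq_one_iff_of_nonneg (norm_nonneg _) two_ne_zero).1 h5⟩

/-- The relations on the state at the maximum of the sum-of-squares bound. -/
theorem phaseAverage_relations {I : Type*} [Fintype I] [Nonempty I] {v : I → ℂ} {κ : ℂ}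
    (hv : IsBalancedPhase v κ) {M : I → K →L[ℂ] K} (hM : ∀ x, IsSelfAdjoint (M x))
    (hM1 : ∀ x φ, ‖M x φ‖ ≤ ‖φ‖)
    {P : K →L[ℂ] K} (hMP : ∀ x, Commute (M x) P) {ψ : K} (hψ : ‖ψ‖ = 1)
    (hP : ‖P ψ‖ ^ 2 + ‖star P ψ‖ ^ 2 ≤ 1)
    (heq : (inner ℂ ψ (phaseAverage v M (P ψ)) : ℂ).re = 1 / 2) :
    star (phaseAverage v M) ψ = P ψ ∧ phaseAverage v M ψ = star P ψ ∧
    phaseAverage v M (star (phaseAverage v M) ψ) +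
      star (phaseAverage v M) (phaseAverage v M ψ) = ψ ∧
    phaseAverage v M (phaseAverage v M ψ) +
      κ • star (phaseAverage v M) (star (phaseAverage v M) ψ) = 0 ∧
    ∀ x, M x ψ = v x • star (phaseAverage v M) ψ + star (v x) • phaseAverage v M ψ := by
  have hMψ : ∀ x, ‖M x ψ‖ ≤ 1 := fun x => hψ ▸ hM1 x ψ
  have hrel := fun x => (apply_eq_of_re_inner_eq hv hM hMP hMψ hP heq x).1
  have hnorm := fun x => (apply_eq_of_re_inner_eq hv hM hMP hMψ hP heq x).2
  have hc : (Fintype.card I : ℂ) ≠ 0 := by simp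
  have hself : ∀ x, v x * star (v x) = 1 := fun x => by rw [mul_comm, hv.star_mul_self]
  -- Averaging `hrel` against `conj (v x)` keeps the `P ψ` term; the other acquires `conj (v x)²`
  -- and sums to zero.
  have e1 : star (phaseAverage v M) ψ = P ψ := by
    rw [star_phaseAverage v M hM, phaseAverage, smul_apply, sum_apply]
    simp only [smul_apply, hrel, Pi.star_apply, smul_add, smul_smul, hv.star_mul_self,
      Finset.sum_add_distrib, ← Finset.sum_smul, ← sq, hv.sum_star_sq]
    simp [hc]
  have e2 : phaseAverage v M ψ = star P ψ := by
    rw [phaseAverage, smul_apply, sum_apply]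
    simp only [smul_apply, hrel, smul_add, smul_smul, hself,
      Finset.sum_add_distrib, ← Finset.sum_smul, ← sq, hv.sum_sq]
    simp [hc]
  have hrel' : ∀ x, M x ψ = v x • star (phaseAverage v M) ψ + star (v x) • phaseAverage v M ψ :=
    fun x => by rw [e1, e2, hrel]
  -- This is `M x (M x ψ) = ψ`, with the inner `M x ψ` expanded. Its plain average gives the third
  -- relation, its average against `v x ^ 2` the fourth.
  have hinv : ∀ x, v x • M x (star (phaseAverage v M) ψ) +
      star (v x) • M x (phaseAverage v M ψ) = ψ := fun x => by
    have := (hM x).apply_apply_eq_self ((hM1 x _).trans (hM1 x ψ)) ((hnorm x).trans hψ.symm)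
    rw [hrel'] at this
    simpa only [map_add, map_smul] using this
  have hsum : ∀ φ : K, ∑ x, v x • M x φ = (Fintype.card I : ℂ) • phaseAverage v M φ := fun φ => by
    rw [← smul_apply, ← sum_phase_smul, sum_apply]; rfl
  have hsum' : ∀ φ : K, ∑ x, star (v x) • M x φ =
      (Fintype.card I : ℂ) • star (phaseAverage v M) φ := fun φ => by
    rw [star_phaseAverage v M hM, ← smul_apply, ← sum_phase_smul, sum_apply]; rfl
  refine ⟨e1, e2, ?_, ?_, hrel'⟩
  · have h := Finset.sum_congr rfl fun x (_ : x ∈ Finset.univ) => hinv x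
    rw [Finset.sum_add_distrib, hsum, hsum', ← smul_add, Finset.sum_const, Finset.card_univ,
      ← Nat.cast_smul_eq_nsmul ℂ] at h
    exact smul_right_injective K hc h
  · have h := Finset.sum_congr rfl fun x (_ : x ∈ Finset.univ) =>
      congrArg (fun φ => v x ^ 2 • φ) (hinv x)
    have hv3 : ∀ x, v x ^ 2 * v x = κ * star (v x) := fun x => by
      rw [← hv.pow_four x]
      linear_combination (-(v x) ^ 3) * hv.star_mul_self x
    have hv1 : ∀ x, v x ^ 2 * star (v x) = v x := fun x => by
      linear_combination (v x) * hv.star_mul_self x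
    simp only [smul_add, smul_smul, hv3, hv1, Finset.sum_add_distrib, ← Finset.sum_smul,
      hv.sum_sq, zero_smul] at h
    simp only [← smul_smul κ, ← Finset.smul_sum] at h
    rw [hsum, hsum', smul_comm κ, ← smul_add, add_comm] at h
    exact (smul_eq_zero.1 h).resolve_left hc

/-- At the maximum, the phase averages of both families are nilpotent on the state. -/
theorem phaseAverage_phaseAverage_eq_zero {I J : Type*} [Fintype I] [Nonempty I] [Fintype J]
    [Nonempty J] {v : I → ℂ} {κ : ℂ} (hv : IsBalancedPhase v κ) {q : J → ℂ} {μ : ℂ}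
    (hq : IsBalancedPhase q μ) (hκμ : κ * μ = -1)
    {M : I → K →L[ℂ] K} (hM : ∀ x, IsSelfAdjoint (M x)) (hM1 : ∀ x φ, ‖M x φ‖ ≤ ‖φ‖)
    {B : J → K →L[ℂ] K} (hB : ∀ y, IsSelfAdjoint (B y)) (hB1 : ∀ y φ, ‖B y φ‖ ≤ ‖φ‖)
    (hMB : ∀ x y, Commute (M x) (B y)) {ψ : K} (hψ : ‖ψ‖ = 1)
    (heq : (inner ℂ ψ (phaseAverage v M (phaseAverage q B ψ)) : ℂ).re = 1 / 2) :
    phaseAverage v M (phaseAverage v M ψ) = 0 := by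
  have hMP : ∀ x, Commute (M x) (phaseAverage q B) := fun x =>
    (Commute.sum_right _ _ _ fun y _ => (hMB x y).smul_right _).smul_right _
  have hBC : ∀ y, Commute (B y) (phaseAverage v M) := fun y =>
    (Commute.sum_right _ _ _ fun x _ => (hMB x y).symm.smul_right _).smul_right _
  have hPC : Commute (phaseAverage v M) (phaseAverage q B) :=
    (Commute.sum_left _ _ _ fun x _ => (hMP x).smul_left _).smul_left _
  have hPC' : Commute (phaseAverage v M) (star (phaseAverage q B)) := by
    rw [star_phaseAverage q B hB]
    exact (Commute.sum_left _ _ _ fun x _ => ((Commute.sum_right _ _ _ fun y _ =>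
      (hMB x y).smul_right _).smul_right _).smul_left _).smul_left _
  have hswap : ∀ {X Y : K →L[ℂ] K}, Commute X Y → ∀ φ, X (Y φ) = Y (X φ) := fun h φ =>
    congrArg (fun T : K →L[ℂ] K => T φ) h
  have hP : ‖phaseAverage q B ψ‖ ^ 2 + ‖star (phaseAverage q B) ψ‖ ^ 2 ≤ 1 := by
    rw [star_phaseAverage q B hB]
    exact norm_sq_phaseAverage_add_le hq fun y => hψ ▸ hB1 y ψ
  have hC : ‖phaseAverage v M ψ‖ ^ 2 + ‖star (phaseAverage v M) ψ‖ ^ 2 ≤ 1 := by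
    rw [star_phaseAverage v M hM]
    exact norm_sq_phaseAverage_add_le hv fun x => hψ ▸ hM1 x ψ
  obtain ⟨a1, a2, -, a4, -⟩ := phaseAverage_relations hv hM hM1 hMP hψ hP heq
  -- The same relations with the two families exchanged.
  obtain ⟨-, -, -, b4, -⟩ := phaseAverage_relations hq hB hB1 hBC hψ hC (by rw [← hswap hPC, heq])
  have hPC'' : Commute (star (phaseAverage v M)) (phaseAverage q B) := by
    simpa using hPC'.star_star
  have c1 : star (phaseAverage v M) (star (phaseAverage v M) ψ) =
      phaseAverage q B (phaseAverage q B ψ) := by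
    rw [a1, hswap hPC'', a1]
  have c2 : phaseAverage v M (phaseAverage v M ψ) =
      star (phaseAverage q B) (star (phaseAverage q B) ψ) := by
    rw [a2, hswap hPC', a2]
  rw [← c1, ← c2] at b4
  -- `κ` times the second family's relation, minus the first family's, leaves only this term; its
  -- coefficient is `-2`.
  have h : (κ * μ - 1) • phaseAverage v M (phaseAverage v M ψ) = 0 := by
    have h1 := congrArg (fun φ => κ • φ) b4
    simp only [smul_add, smul_smul, smul_zero] at h1
    rw [sub_smul, one_smul, ← add_sub_add_left_eq_sub _ _
      (κ • star (phaseAverage v M) (star (phaseAverage v M) ψ)), h1, add_comm, a4, sub_zero]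
  rw [hκμ] at h
  exact (smul_eq_zero.1 h).resolve_left (by norm_num)

end Bipartite

/-! ### Tensor products of families of observables -/

/-- The sum of squares factors over `o`, so a single cancelling factor suffices; the others may be
trivial. -/
theorem IsBalancedPhase.prod {O : Type*} [Fintype O] [DecidableEq O] {ι : O → Type*}
    [∀ o, Fintype (ι o)] {p : ∀ o, ι o → ℂ} {κ : O → ℂ} (hn : ∀ o x, ‖p o x‖ = 1)
    (h4 : ∀ o x, p o x ^ 4 = κ o) (hs : ∃ o, ∑ x, p o x ^ 2 = 0) :
    IsBalancedPhase (fun y : ∀ o, ι o => ∏ o, p o (y o)) (∏ o, κ o) where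
  norm_eq y := by rw [norm_prod]; exact Finset.prod_eq_one fun o _ => hn o _
  pow_four y := by rw [← Finset.prod_pow]; exact Finset.prod_congr rfl fun o _ => h4 o _
  sum_sq := by
    obtain ⟨o, ho⟩ := hs
    have := Finset.prod_univ_sum (fun o : O => (Finset.univ : Finset (ι o)))
      (fun o x => p o x ^ 2)
    rw [Fintype.piFinset_univ, Finset.prod_eq_zero (Finset.mem_univ o) ho] at this
    simp only [← Finset.prod_pow]
    exact this.symm

theorem norm_phaseAverage_le {K : Type*} [NormedAddCommGroup K] [InnerProductSpace ℂ K]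
    {I : Type*} [Fintype I] [Nonempty I] {p : I → ℂ} (hp : ∀ x, ‖p x‖ = 1)
    {M : I → K →L[ℂ] K} (hM : ∀ x, ‖M x‖ ≤ 1) : ‖phaseAverage p M‖ ≤ 1 := by
  have hc : (0 : ℝ) < Fintype.card I := by exact_mod_cast Fintype.card_pos
  rw [phaseAverage, norm_smul, norm_inv, Complex.norm_natCast, inv_mul_le_iff₀ hc]
  refine (norm_sum_le _ _).trans ((Finset.sum_le_card_nsmul _ _ 1 fun x _ => ?_).trans ?_)
  · rw [norm_smul, hp, one_mul]; exact hM x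
  · simp

namespace ClusterStrategy

variable {N k : ℕ} {c : Fin N → Fin k} (S : ClusterStrategy.{u, v} c)

/-- The operator `X` of cluster `j`, acting on the global space. -/
noncomputable def localOp (j : Fin k) (X : S.H (some j) →L[ℂ] S.H (some j)) : S.K →L[ℂ] S.K :=
  S.tensorOp (Pi.mulSingle j X)

theorem localOp_mul (j : Fin k) (X Y : S.H (some j) →L[ℂ] S.H (some j)) :
    S.localOp j (X * Y) = S.localOp j X * S.localOp j Y := by
  rw [localOp, Pi.mulSingle_mul, S.tensorOp_mul, localOp, localOp]

theorem localOp_one (j : Fin k) : S.localOp j 1 = 1 := by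
  rw [localOp, Pi.mulSingle_one, S.tensorOp_one]

theorem localOp_star (j : Fin k) (X : S.H (some j) →L[ℂ] S.H (some j)) :
    S.localOp j (star X) = star (S.localOp j X) := by
  rw [localOp, localOp, ← S.tensorOp_star]
  congr 1
  funext l
  by_cases h : l = j
  · subst h; simp
  · simp [Pi.mulSingle_eq_of_ne h]

theorem localOp_isSelfAdjoint {j : Fin k} {X : S.H (some j) →L[ℂ] S.H (some j)}
    (hX : IsSelfAdjoint X) : IsSelfAdjoint (S.localOp j X) := by
  rw [IsSelfAdjoint, ← S.localOp_star, hX.star_eq]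

/-- `localOp` as a linear map. -/
noncomputable def localOpLinear (j : Fin k) :
    (S.H (some j) →L[ℂ] S.H (some j)) →ₗ[ℂ] (S.K →L[ℂ] S.K) :=
  S.tensorOpMultilinear.toLinearMap 1 j

theorem localOpLinear_apply (j : Fin k) (X : S.H (some j) →L[ℂ] S.H (some j)) :
    S.localOpLinear j X = S.localOp j X := rfl

theorem localOp_sub (j : Fin k) (X Y : S.H (some j) →L[ℂ] S.H (some j)) :
    S.localOp j (X - Y) = S.localOp j X - S.localOp j Y := by
  simp only [← S.localOpLinear_apply, map_sub]

theorem localOp_phaseAverage (j : Fin k) {I : Type*} [Fintype I] (p : I → ℂ)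
    (M : I → S.H (some j) →L[ℂ] S.H (some j)) :
    S.localOp j (phaseAverage p M) = phaseAverage p (fun x => S.localOp j (M x)) := by
  simp only [phaseAverage, ← S.localOpLinear_apply, map_smul, map_sum]

theorem norm_localOp_apply_le {j : Fin k} {X : S.H (some j) →L[ℂ] S.H (some j)} (hX : ‖X‖ ≤ 1)
    (φ : S.K) : ‖S.localOp j X φ‖ ≤ ‖φ‖ := by
  refine S.norm_tensorOp_apply_le _ (fun l => ?_) φ
  by_cases h : l = j
  · subst h; simpa using hX
  · rw [Pi.mulSingle_eq_of_ne h]; exact ContinuousLinearMap.norm_id_le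

theorem commute_localOp {j : Fin k} (X : S.H (some j) →L[ℂ] S.H (some j)) {A : S.LocalOps}
    (hA : A j = 1) : Commute (S.localOp j X) (S.tensorOp A) := by
  rw [Commute, SemiconjBy, localOp, ← S.tensorOp_mul, ← S.tensorOp_mul]
  congr 1
  funext l
  by_cases h : l = j
  · subst h; simp [hA]
  · simp [Pi.mulSingle_eq_of_ne h]

theorem localOp_apply_tensorOp_apply {j : Fin k} (X : S.H (some j) →L[ℂ] S.H (some j))
    {A : S.LocalOps} (hA : A j = 1) (φ : S.K) :
    S.localOp j X (S.tensorOp A φ) = S.tensorOp A (S.localOp j X φ) :=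
  congrArg (fun T : S.K →L[ℂ] S.K => T φ) (S.commute_localOp X hA)

theorem tensorOp_eq_localOp_mul (A : S.LocalOps) (j : Fin k) :
    S.tensorOp A = S.localOp j (A j) * S.tensorOp (Function.update A j 1) := by
  rw [localOp, ← S.tensorOp_mul]
  congr 1
  funext l
  by_cases h : l = j
  · subst h; simp
  · simp [Pi.mulSingle_eq_of_ne h, Function.update_of_ne h]

theorem tensorOp_apply_eq_left (A : S.LocalOps) (j : Fin k) (φ : S.K) :
    S.tensorOp A φ = S.localOp j (A j) (S.tensorOp (Function.update A j 1) φ) :=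
  congrArg (fun T : S.K →L[ℂ] S.K => T φ) (S.tensorOp_eq_localOp_mul A j)

theorem tensorOp_apply_eq (A : S.LocalOps) (j : Fin k) (φ : S.K) :
    S.tensorOp A φ = S.tensorOp (Function.update A j 1) (S.localOp j (A j) φ) := by
  rw [S.tensorOp_apply_eq_left A j, S.localOp_apply_tensorOp_apply _ (by simp)]

theorem tensorOp_phaseAverage {ι : Fin k → Type*} [∀ j, Fintype (ι j)] (p : ∀ j, ι j → ℂ)
    (M : ∀ j, ι j → S.H (some j) →L[ℂ] S.H (some j)) :
    S.tensorOp (fun j => phaseAverage (p j) (M j)) =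
      phaseAverage (fun y : ∀ j, ι j => ∏ j, p j (y j))
        (fun y => S.tensorOp fun j => M j (y j)) := by
  simp only [← S.tensorOpMultilinear_apply, phaseAverage]
  rw [MultilinearMap.map_smul_univ, MultilinearMap.map_sum]
  simp only [MultilinearMap.map_smul_univ]
  rw [Fintype.card_pi]
  push_cast
  rw [Finset.prod_inv_distrib]

theorem tensorOp_isSelfAdjoint {A : S.LocalOps} (hA : ∀ j, IsSelfAdjoint (A j)) :
    IsSelfAdjoint (S.tensorOp A) := by
  rw [IsSelfAdjoint, ← S.tensorOp_star]
  congr 1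
  funext j
  exact hA j

theorem phaseAverage_one {K : Type*} [NormedAddCommGroup K] [InnerProductSpace ℂ K]
    {I : Type*} [Fintype I] [Nonempty I] :
    phaseAverage (1 : I → ℂ) (1 : I → K →L[ℂ] K) = 1 := by
  simp only [phaseAverage, Pi.one_apply, one_smul, Finset.sum_const, Finset.card_univ]
  rw [← Nat.cast_smul_eq_nsmul ℂ, smul_smul, inv_mul_cancel₀ (by simp), one_smul]

/-- The relations satisfied by ladder operators `C j` acting on (a local dilation of) a
GHZ state. -/
structure GHZRelations (C : S.LocalOps) : Prop where
  star_apply : ∀ j, S.localOp j (star (C j)) S.ψ = S.tensorOp (Function.update C j 1) S.ψ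
  apply : ∀ j, S.localOp j (C j) S.ψ = S.tensorOp (Function.update (star C) j 1) S.ψ
  add : ∀ j, S.localOp j (C j) (S.localOp j (star (C j)) S.ψ) +
    S.localOp j (star (C j)) (S.localOp j (C j) S.ψ) = S.ψ
  sq : ∀ j, S.localOp j (C j) (S.localOp j (C j) S.ψ) = 0

/-! ### The bound and its equality case for all clusters -/

section PhaseAverage

variable {ι : Fin k → Type*} {p : ∀ j, ι j → ℂ}
  {κ : Fin k → ℂ} {M : ∀ j, ι j → S.H (some j) →L[ℂ] S.H (some j)}

theorem update_isSelfAdjoint (hM : ∀ j x, IsSelfAdjoint (M j x)) (j : Fin k) (y : ∀ l, ι l) :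
    IsSelfAdjoint (S.tensorOp fun l => Function.update M j 1 l (y l)) := by
  refine S.tensorOp_isSelfAdjoint fun l => ?_
  by_cases h : l = j
  · subst h; simp
  · simpa [Function.update_of_ne h] using hM l _

theorem norm_update_apply_le (hM1 : ∀ j x, ‖M j x‖ ≤ 1) (j : Fin k) (y : ∀ l, ι l) (φ : S.K) :
    ‖S.tensorOp (fun l => Function.update M j 1 l (y l)) φ‖ ≤ ‖φ‖ := by
  refine S.norm_tensorOp_apply_le _ (fun l => ?_) φ
  by_cases h : l = j
  · subst h
    simp only [Function.update_self, Pi.one_apply]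
    exact ContinuousLinearMap.norm_id_le
  · simpa [Function.update_of_ne h] using hM1 l _

variable [∀ j, Fintype (ι j)]

/-- With at least two clusters, some cluster other than `j` still has cancelling squares. -/
theorem isBalancedPhase_update (hk : 2 ≤ k) (hp : ∀ j, IsBalancedPhase (p j) (κ j)) (j : Fin k) :
    IsBalancedPhase (fun y : ∀ l, ι l => ∏ l, Function.update p j 1 l (y l))
      (∏ l, Function.update κ j 1 l) := by
  refine IsBalancedPhase.prod (fun l x => ?_) (fun l x => ?_) ?_
  · by_cases h : l = j
    · subst h; simp
    · simp [Function.update_of_ne h, (hp l).norm_eq]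
  · by_cases h : l = j
    · subst h; simp
    · simp [Function.update_of_ne h, (hp l).pow_four]
  · have : Nontrivial (Fin k) := Fin.nontrivial_iff_two_le.2 hk
    obtain ⟨l, hl⟩ := exists_ne j
    exact ⟨l, by simp only [Function.update_of_ne hl, (hp l).sum_sq]⟩

variable [∀ j, Nonempty (ι j)]

theorem tensorOp_update_phaseAverage (j : Fin k) :
    S.tensorOp (Function.update (fun l => phaseAverage (p l) (M l)) j 1) =
      phaseAverage (fun y : ∀ l, ι l => ∏ l, Function.update p j 1 l (y l))
        (fun y => S.tensorOp fun l => Function.update M j 1 l (y l)) := by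
  rw [← S.tensorOp_phaseAverage]
  congr 1
  funext l
  by_cases h : l = j
  · subst h; simp [phaseAverage_one]
  · simp [Function.update_of_ne h]

theorem norm_sq_tensorOp_update_le (hk : 2 ≤ k) (hp : ∀ j, IsBalancedPhase (p j) (κ j))
    (hM : ∀ j x, IsSelfAdjoint (M j x)) (hM1 : ∀ j x, ‖M j x‖ ≤ 1) (j : Fin k) :
    ‖S.tensorOp (Function.update (fun l => phaseAverage (p l) (M l)) j 1) S.ψ‖ ^ 2 +
      ‖star (S.tensorOp (Function.update (fun l => phaseAverage (p l) (M l)) j 1)) S.ψ‖ ^ 2 ≤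
        1 := by
  rw [S.tensorOp_update_phaseAverage, star_phaseAverage _ _ (S.update_isSelfAdjoint hM j)]
  exact norm_sq_phaseAverage_add_le (isBalancedPhase_update hk hp j) fun y =>
    S.norm_ψ ▸ S.norm_update_apply_le hM1 j y S.ψ

theorem re_inner_tensorOp_phaseAverage_le (hk : 2 ≤ k)
    (hp : ∀ j, IsBalancedPhase (p j) (κ j)) (hM : ∀ j x, IsSelfAdjoint (M j x))
    (hM1 : ∀ j x, ‖M j x‖ ≤ 1) :
    (inner ℂ S.ψ (S.tensorOp (fun j => phaseAverage (p j) (M j)) S.ψ) : ℂ).re ≤ 1 / 2 := by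
  let j : Fin k := ⟨0, by omega⟩
  rw [S.tensorOp_apply_eq_left _ j, S.localOp_phaseAverage]
  exact re_inner_phaseAverage_le (hp j) (fun x => S.localOp_isSelfAdjoint (hM j x))
    (fun x => S.commute_localOp _ (by simp))
    (fun x => S.norm_ψ ▸ S.norm_localOp_apply_le (hM1 j x) S.ψ)
    (S.norm_sq_tensorOp_update_le hk hp hM hM1 j)

/-- Every cluster may play the role of the one cut from the rest, so the bipartite relations hold at
each `j`. Nilpotency uses that `κ j` times the product of the remaining `κ l` is `-1`, whichever `j`
is cut. -/
theorem ghzRelations_of_re_inner_eq (hk : 2 ≤ k)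
    (hp : ∀ j, IsBalancedPhase (p j) (κ j)) (hκ : ∏ j, κ j = -1)
    (hM : ∀ j x, IsSelfAdjoint (M j x)) (hM1 : ∀ j x, ‖M j x‖ ≤ 1)
    (heq : (inner ℂ S.ψ (S.tensorOp (fun j => phaseAverage (p j) (M j)) S.ψ) : ℂ).re = 1 / 2) :
    S.GHZRelations (fun j => phaseAverage (p j) (M j)) ∧
    ∀ j x, S.localOp j (M j x) S.ψ = p j x • S.localOp j (star (phaseAverage (p j) (M j))) S.ψ +
      star (p j x) • S.localOp j (phaseAverage (p j) (M j)) S.ψ := by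
  have hsa := fun j x => S.localOp_isSelfAdjoint (hM j x)
  have hle := fun j x => S.norm_localOp_apply_le (hM1 j x)
  have heq' : ∀ j, (inner ℂ S.ψ (phaseAverage (p j) (fun x => S.localOp j (M j x))
      (S.tensorOp (Function.update (fun l => phaseAverage (p l) (M l)) j 1) S.ψ)) : ℂ).re =
        1 / 2 := fun j => by
    rw [← S.localOp_phaseAverage]
    rwa [S.tensorOp_apply_eq_left _ j] at heq
  have hrel := fun j => phaseAverage_relations (hp j) (hsa j) (hle j)
    (fun x => S.commute_localOp (M j x) (by simp)) S.norm_ψ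
    (S.norm_sq_tensorOp_update_le hk hp hM hM1 j) (heq' j)
  simp only [← S.localOp_phaseAverage, ← S.localOp_star] at hrel
  refine ⟨⟨fun j => (hrel j).1, fun j => ?_, fun j => (hrel j).2.2.1, fun j => ?_⟩,
    fun j => (hrel j).2.2.2.2⟩
  · rw [(hrel j).2.1, ← S.tensorOp_star]
    congr 2
    funext l
    by_cases h : l = j
    · subst h; simp
    · simp [Function.update_of_ne h]
  · rw [S.localOp_phaseAverage]
    refine phaseAverage_phaseAverage_eq_zero (hp j) (isBalancedPhase_update hk hp j) ?_ (hsa j)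
      (hle j) (S.update_isSelfAdjoint hM j) (S.norm_update_apply_le hM1 j)
      (fun x y => S.commute_localOp _ (by simp)) S.norm_ψ ?_
    · rw [Finset.prod_update_of_mem (Finset.mem_univ j), one_mul, ← hκ,
        ← Finset.mul_prod_erase _ _ (Finset.mem_univ j), Finset.sdiff_singleton_eq_erase]
    · rw [← S.tensorOp_update_phaseAverage]
      exact heq' j

end PhaseAverage

end ClusterStrategy

/-! ### Extraction of the GHZ state -/

namespace ClusterStrategy

variable {N k : ℕ} {c : Fin N → Fin k} (S : ClusterStrategy.{u, v} c)

theorem isTensorIsometry_apply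
    {V : ∀ j : Fin k, S.H (some j) →ₗᵢ[ℂ] PiLp 2 (fun _ : Fin 2 => S.H (some j))}
    {Λ : S.K →ₗᵢ[ℂ] PiLp 2 (fun _ : Fin k → Fin 2 => S.K)} (hΛ : S.IsTensorIsometry V Λ)
    {W : ∀ j : Fin k, Fin 2 → S.H (some j) →L[ℂ] S.H (some j)}
    (hV : ∀ j b x, V j x b = W j b x) (φ : S.K) (τ : Fin k → Fin 2) :
    Λ φ τ = S.tensorOp (fun j => W j (τ j)) φ := by
  have h : (PiLp.proj 2 (fun _ : Fin k → Fin 2 => S.K) τ :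
      PiLp 2 (fun _ : Fin k → Fin 2 => S.K) →L[ℂ] S.K).comp Λ.toContinuousLinearMap =
      S.tensorOp (fun j => W j (τ j)) := by
    refine S.ext_of_tmul fun x => ?_
    change Λ (S.tmul x) τ = _
    rw [hΛ, S.tensorOp_tmul]
    congr 1
    funext o
    cases o with
    | none => rfl
    | some j => exact hV j _ _
  exact congrArg (fun T : S.K →L[ℂ] S.K => T φ) h

/-- The family equal to `A` on `F` and to the identity elsewhere. -/
noncomputable def restrictOps (F : Finset (Fin k)) (A : S.LocalOps) : S.LocalOps :=
  fun j => if j ∈ F then A j else 1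

theorem restrictOps_univ (A : S.LocalOps) : S.restrictOps Finset.univ A = A := by
  funext j; simp [restrictOps]

theorem tensorOp_restrictOps_insert (A : S.LocalOps) {F : Finset (Fin k)} {a : Fin k}
    (ha : a ∉ F) (φ : S.K) :
    S.tensorOp (S.restrictOps (insert a F) A) φ =
      S.localOp a (A a) (S.tensorOp (S.restrictOps F A) φ) := by
  rw [S.tensorOp_apply_eq_left _ a]
  congr 2
  · simp [restrictOps]
  · congr 1
    funext l
    by_cases h : l = a
    · subst h; simp [restrictOps, ha]
    · simp [restrictOps, h]

theorem tensorOp_restrictOps_empty (A : S.LocalOps) (φ : S.K) :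
    S.tensorOp (S.restrictOps ∅ A) φ = φ := by
  have : S.restrictOps ∅ A = 1 := by funext j; simp [restrictOps]
  rw [this, S.tensorOp_one, one_apply_eq_self]

theorem tensorOp_apply_eq_self {A : S.LocalOps} {φ : S.K} (h : ∀ j, S.localOp j (A j) φ = φ) :
    S.tensorOp A φ = φ := by
  have : ∀ F : Finset (Fin k), S.tensorOp (S.restrictOps F A) φ = φ := fun F => by
    induction F using Finset.induction_on with
    | empty => exact S.tensorOp_restrictOps_empty A φ
    | insert a F ha ih => rw [S.tensorOp_restrictOps_insert A ha, ih, h]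
  simpa only [S.restrictOps_univ] using this Finset.univ

theorem tensorOp_apply_eq_zero {A : S.LocalOps} {φ : S.K} {j : Fin k}
    (h : S.localOp j (A j) φ = 0) : S.tensorOp A φ = 0 := by
  rw [S.tensorOp_apply_eq A j, h, map_zero]

theorem localOp_comm {a b : Fin k} (hab : a ≠ b) (X : S.H (some a) →L[ℂ] S.H (some a))
    (Y : S.H (some b) →L[ℂ] S.H (some b)) (φ : S.K) :
    S.localOp a X (S.localOp b Y φ) = S.localOp b Y (S.localOp a X φ) := by
  have h : (Pi.mulSingle b Y : S.LocalOps) a = 1 := by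
    rw [Pi.mulSingle_eq_of_ne hab]
  rw [show S.localOp b Y = S.tensorOp (Pi.mulSingle b Y) from rfl,
    S.localOp_apply_tensorOp_apply X h]

namespace GHZRelations

variable {S} {C : S.LocalOps}

theorem tensorOp_eq (h : S.GHZRelations C) (j : Fin k) :
    S.tensorOp C S.ψ = S.localOp j (C j) (S.localOp j (star (C j)) S.ψ) := by
  rw [S.tensorOp_apply_eq_left C j, h.star_apply]

theorem tensorOp_star_eq (h : S.GHZRelations C) (j : Fin k) :
    S.tensorOp (star C) S.ψ = S.localOp j (star (C j)) (S.localOp j (C j) S.ψ) := by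
  rw [S.tensorOp_apply_eq_left (star C) j, h.apply]; rfl

theorem tensorOp_add_star (h : S.GHZRelations C) (j : Fin k) :
    S.tensorOp C S.ψ + S.tensorOp (star C) S.ψ = S.ψ := by
  rw [h.tensorOp_eq j, h.tensorOp_star_eq j, h.add]

theorem localOp_tensorOp (h : S.GHZRelations C) (j : Fin k) :
    S.localOp j (C j) (S.tensorOp C S.ψ) = 0 := by
  rw [S.tensorOp_apply_eq_left C j, S.localOp_apply_tensorOp_apply _ (by simp),
    S.localOp_apply_tensorOp_apply _ (by simp), h.sq, map_zero]

theorem localOp_tensorOp_star (h : S.GHZRelations C) (j : Fin k) :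
    S.localOp j (C j) (S.tensorOp (star C) S.ψ) = S.localOp j (C j) S.ψ := by
  conv_rhs => rw [← h.tensorOp_add_star j, map_add, h.localOp_tensorOp, zero_add]

/-- `C b⋆ ψ` equals the product of all the other ladder operators on `ψ`. That product contains `C
a`, and `C a² ψ = 0`. -/
theorem localOp_localOp_star (h : S.GHZRelations C) {a b : Fin k} (hab : a ≠ b) :
    S.localOp a (C a) (S.localOp b (star (C b)) S.ψ) = 0 := by
  rw [h.star_apply, S.tensorOp_apply_eq _ a, S.localOp_apply_tensorOp_apply _ (by simp),
    Function.update_of_ne hab, h.sq, map_zero]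

/-- Products of observables of the form `w j C j⋆ + w̄ j C j` on the state. -/
theorem tensorOp_apply_of_localOp_apply (h : S.GHZRelations C) (hk : 2 ≤ k)
    {M : S.LocalOps} {w : Fin k → ℂ}
    (hM : ∀ j, S.localOp j (M j) S.ψ =
      w j • S.localOp j (star (C j)) S.ψ + star (w j) • S.localOp j (C j) S.ψ) :
    S.tensorOp M S.ψ =
      (∏ j, w j) • S.tensorOp (star C) S.ψ + (∏ j, star (w j)) • S.tensorOp C S.ψ := by
  -- Induction over sets of clusters. Adding a cluster creates mixed terms with some `C a` and `C
  -- b⋆`, `a ≠ b`, which vanish on the state.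
  have key : ∀ F : Finset (Fin k), F.Nonempty → S.tensorOp (S.restrictOps F M) S.ψ =
      (∏ j ∈ F, w j) • S.tensorOp (S.restrictOps F (star C)) S.ψ +
        (∏ j ∈ F, star (w j)) • S.tensorOp (S.restrictOps F C) S.ψ := by
    intro F hF
    induction hF using Finset.Nonempty.cons_induction with
    | singleton a =>
      rw [← insert_empty_eq]
      simp only [S.tensorOp_restrictOps_insert _ (Finset.notMem_empty a),
        S.tensorOp_restrictOps_empty, hM]
      simp
    | cons a F ha hF ih =>
      obtain ⟨b, hb⟩ := hF
      have hab : a ≠ b := fun hab => ha (hab ▸ hb)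
      rw [Finset.cons_eq_insert, Finset.prod_insert ha, Finset.prod_insert ha]
      simp only [S.tensorOp_restrictOps_insert _ ha, ih, map_add, map_smul]
      have hout : ∀ B : S.LocalOps, S.restrictOps F B a = 1 := fun B => by simp [restrictOps, ha]
      have hin : ∀ B : S.LocalOps, S.restrictOps F B b = B b := fun B => by simp [restrictOps, hb]
      have z1 : S.tensorOp (S.restrictOps F (star C)) (S.localOp a (C a) S.ψ) = 0 := by
        refine S.tensorOp_apply_eq_zero (j := b) ?_
        rw [hin, ← S.localOp_comm hab]
        exact h.localOp_localOp_star hab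
      have z2 : S.tensorOp (S.restrictOps F C) (S.localOp a (star (C a)) S.ψ) = 0 := by
        refine S.tensorOp_apply_eq_zero (j := b) ?_
        rw [hin]
        exact h.localOp_localOp_star hab.symm
      simp only [S.localOp_apply_tensorOp_apply _ (hout _), hM, map_add, map_smul, z1, z2,
        smul_zero, add_zero, zero_add, smul_smul, Pi.star_apply]
      rw [mul_comm (w a), mul_comm (star (w a))]
  have hne : (Finset.univ : Finset (Fin k)).Nonempty := ⟨⟨0, by omega⟩, Finset.mem_univ _⟩
  simpa only [S.restrictOps_univ] using key Finset.univ hne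

/-- The halves `(⨂ C j) ψ` and `(⨂ C j⋆) ψ` are orthogonal and sum to `ψ`. -/
theorem norm_sq_tensorOp (h : S.GHZRelations C) (hk : 2 ≤ k) :
    ‖S.tensorOp C S.ψ‖ ^ 2 = (inner ℂ S.ψ (S.tensorOp C S.ψ) : ℂ).re := by
  let j : Fin k := ⟨0, by omega⟩
  have h1 : (inner ℂ (S.tensorOp (star C) S.ψ) (S.tensorOp C S.ψ) : ℂ) = 0 := by
    rw [h.tensorOp_star_eq j, S.localOp_star, inner_star_apply_left, h.localOp_tensorOp,
      inner_zero_right]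
  have h2 : (inner ℂ S.ψ (S.tensorOp C S.ψ) : ℂ) =
      inner ℂ (S.tensorOp C S.ψ) (S.tensorOp C S.ψ) := by
    have h3 : (inner ℂ S.ψ (S.tensorOp C S.ψ) : ℂ) =
        inner ℂ (S.tensorOp C S.ψ + S.tensorOp (star C) S.ψ) (S.tensorOp C S.ψ) := by
      rw [h.tensorOp_add_star j]
    rw [h3, inner_add_left, h1, add_zero]
  rw [h2, ← RCLike.re_eq_complex_re, inner_self_eq_norm_sq]

/-- The isometry built from the ladder operators and their defect operators. -/
theorem exists_isometry (h : S.GHZRelations C) (hk : 2 ≤ k) (hC : ∀ j, ‖C j‖ ≤ 1) :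
    ∃ (V : ∀ j : Fin k, S.H (some j) →ₗᵢ[ℂ] PiLp 2 (fun _ : Fin 2 => S.H (some j)))
      (Λ : S.K →ₗᵢ[ℂ] PiLp 2 (fun _ : Fin k → Fin 2 => S.K)), S.IsTensorIsometry V Λ ∧
      (∀ τ, Λ (S.tensorOp C S.ψ) τ = if ∀ j, τ j = 0 then S.tensorOp C S.ψ else 0) ∧
      (∀ τ, Λ (S.tensorOp (star C) S.ψ) τ = if ∀ j, τ j = 1 then S.tensorOp C S.ψ else 0) := by
  choose q hq hq2 using fun j => exists_defect_root (C j) (hC j)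
  have hr : ∀ j, IsSelfAdjoint (q j * q j) := fun j => by
    rw [IsSelfAdjoint, star_mul, (hq j).star_eq]
  choose V hV using fun j => exists_dilation (C j) (q j * q j) (hr j) (hq2 j)
  obtain ⟨Λ, hΛ⟩ := S.exists_isTensorIsometry V
  have hΛ' := S.isTensorIsometry_apply hΛ (W := fun j => ![q j * q j, C j]) (fun j b x => by
    fin_cases b
    · exact (hV j x).1
    · exact (hV j x).2)
  have hrr : ∀ j φ, S.localOp j (q j * q j) (S.localOp j (q j * q j) φ) =
      φ - S.localOp j (star (C j)) (S.localOp j (C j) φ) := fun j φ => by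
    rw [← mul_apply_eq_comp, ← S.localOp_mul, hq2, S.localOp_sub, S.localOp_one, S.localOp_mul]
    rfl
  have hr0 : ∀ j, S.localOp j (q j * q j) (S.tensorOp C S.ψ) = S.tensorOp C S.ψ := fun j => by
    have h1 := hrr j (S.tensorOp C S.ψ)
    rw [h.localOp_tensorOp, map_zero, sub_zero] at h1
    set ζ := S.tensorOp C S.ψ
    set R := S.localOp j (q j * q j) with hR
    -- `R ζ - ζ` is an eigenvector of `R` for `-1` unless it is zero; `R` is a square of a
    -- self-adjoint operator, which excludes the former.
    have h2 : R (R ζ - ζ) = -(R ζ - ζ) := by rw [map_sub, h1]; abel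
    have h3 : ∀ φ, (inner ℂ φ (R φ) : ℂ).re = ‖S.localOp j (q j) φ‖ ^ 2 := fun φ => by
      rw [hR, S.localOp_mul, mul_apply_eq_comp,
        ← (S.localOp_isSelfAdjoint (hq j)).inner_map_left, ← RCLike.re_eq_complex_re,
        inner_self_eq_norm_sq]
    have h3 := h3 (R ζ - ζ)
    rw [h2, inner_neg_right, Complex.neg_re, ← RCLike.re_eq_complex_re, inner_self_eq_norm_sq] at h3
    have h4 : ‖R ζ - ζ‖ ^ 2 = 0 := by
      nlinarith [sq_nonneg ‖R ζ - ζ‖, sq_nonneg ‖S.localOp j (q j) (R ζ - ζ)‖]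
    exact sub_eq_zero.1 (norm_eq_zero.1 (pow_eq_zero_iff two_ne_zero |>.1 h4))
  -- On the second half `C⋆ C` acts as the identity, so the squared defect operator kills it;
  -- self-adjointness passes this to the defect operator.
  have hr1 : ∀ j, S.localOp j (q j * q j) (S.tensorOp (star C) S.ψ) = 0 := fun j => by
    have h1 := hrr j (S.tensorOp (star C) S.ψ)
    rw [h.localOp_tensorOp_star, ← h.tensorOp_star_eq, sub_self] at h1
    have h2 := (S.localOp_isSelfAdjoint (hr j)).inner_map_left (S.tensorOp (star C) S.ψ)
      (S.localOp j (q j * q j) (S.tensorOp (star C) S.ψ))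
    rw [h1, inner_zero_right] at h2
    exact inner_self_eq_zero.1 h2
  have hb : ∀ b : Fin 2, b ≠ 0 → b = 1 := by decide
  refine ⟨V, Λ, hΛ, fun τ => ?_, fun τ => ?_⟩
  · rw [hΛ']
    split_ifs with hτ
    · refine S.tensorOp_apply_eq_self fun j => ?_
      simp only [hτ j]
      exact hr0 j
    · push Not at hτ
      obtain ⟨j, hj⟩ := hτ
      refine S.tensorOp_apply_eq_zero (j := j) ?_
      simp only [hb _ hj]
      exact h.localOp_tensorOp j
  · rw [hΛ']
    split_ifs with hτ
    · have : (fun j => (![q j * q j, C j] : Fin 2 → _) (τ j)) = C := by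
        funext j; rw [hτ j]; rfl
      rw [this]
      let j : Fin k := ⟨0, by omega⟩
      -- `⨂ C j` kills the first half, so it takes the second half to the same vector as `ψ`.
      have h1 : S.tensorOp C (S.tensorOp C S.ψ) = 0 :=
        S.tensorOp_apply_eq_zero (h.localOp_tensorOp j)
      have h2 := congrArg (S.tensorOp C) (h.tensorOp_add_star j)
      rwa [map_add, h1, zero_add] at h2
    · push Not at hτ
      obtain ⟨j, hj⟩ := hτ
      refine S.tensorOp_apply_eq_zero (j := j) ?_
      have : τ j = 0 := by by_contra h0; exact hj (hb _ h0)
      simp only [this]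
      exact hr1 j

end GHZRelations

end ClusterStrategy

/-! ### Bit strings and phases -/

theorem bijective_clusterPart {N k : ℕ} (c : Fin N → Fin k) :
    Function.Bijective (fun (x : Fin N → Fin 2) (j : Fin k) => clusterPart c j x) := by
  refine ⟨fun x y h => ?_, fun y => ⟨fun i => y (c i) ⟨i, rfl⟩, ?_⟩⟩
  · funext i
    exact congrFun (congrFun h (c i)) ⟨i, rfl⟩
  · funext j ⟨i, hi⟩
    subst hi
    rfl

theorem hammingWeight_eq_sum {N k : ℕ} (c : Fin N → Fin k) (x : Fin N → Fin 2) :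
    hammingWeight x = ∑ j, hammingWeight (clusterPart c j x) :=
  (Fintype.sum_fiberwise c (fun i => (x i : ℕ))).symm

theorem sum_neg_one_pow_hammingWeight {I : Type*} [Fintype I] [DecidableEq I] [Nonempty I] :
    ∑ x : I → Fin 2, (-1 : ℂ) ^ hammingWeight x = 0 := by
  have := Finset.prod_univ_sum (fun _ : I => (Finset.univ : Finset (Fin 2)))
    (fun _ b => (-1 : ℂ) ^ (b : ℕ))
  rw [Fintype.piFinset_univ] at this
  simp only [hammingWeight, ← Finset.prod_pow_eq_pow_sum]
  rw [← this]
  simp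

/-- The phase factor attached to an input string of weight `w` of cluster `j`. -/
noncomputable def svetlichnyPhase {k : ℕ} (s σ : ℤˣ) (j : Fin k) (w : ℕ) : ℂ :=
  (if (j : ℕ) = 0 then
      ((σ : ℤ) : ℂ) * ((1 / Real.sqrt 2 : ℝ) : ℂ) * (1 + ((s : ℤ) : ℂ) * Complex.I)
    else 1) * Complex.I ^ w

theorem inv_sqrt_two_sq : (((1 / Real.sqrt 2 : ℝ) : ℂ)) ^ 2 = 1 / 2 := by
  rw [← Complex.ofReal_pow, div_pow, Real.sq_sqrt (by norm_num)]
  norm_num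

theorem intUnits_sq (s : ℤˣ) : (((s : ℤ) : ℂ)) ^ 2 = 1 := by
  rcases Int.units_eq_one_or s with rfl | rfl <;> simp

/-- The sign comes from `((1 + s I) / √2)⁴ = -1`. It occurs at the first cluster only, so the
product over all clusters is `-1`. -/
theorem svetlichnyPhase_pow_four {k : ℕ} (s σ : ℤˣ) (j : Fin k) (w : ℕ) :
    svetlichnyPhase s σ j w ^ 4 = if (j : ℕ) = 0 then -1 else 1 := by
  have hI : (Complex.I ^ w) ^ 4 = 1 := by
    rw [← pow_mul, mul_comm, pow_mul, Complex.I_pow_four, one_pow]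
  rw [svetlichnyPhase, mul_pow, hI, mul_one]
  split_ifs
  · have h1 := inv_sqrt_two_sq
    have h2 := intUnits_sq s
    have h3 := intUnits_sq σ
    have e : (1 + ((s : ℤ) : ℂ) * Complex.I) ^ 2 = 2 * (s : ℤ) * Complex.I := by
      linear_combination h2 * Complex.I ^ 2 + Complex.I_sq
    calc _ = ((((σ : ℤ) : ℂ)) ^ 2) ^ 2 * (((1 / Real.sqrt 2 : ℝ) : ℂ) ^ 2) ^ 2 *
        ((1 + ((s : ℤ) : ℂ) * Complex.I) ^ 2) ^ 2 := by ring
      _ = -1 := by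
        rw [h3, h1, e, mul_pow, mul_pow, h2, Complex.I_sq]
        norm_num
  · simp

theorem norm_svetlichnyPhase {k : ℕ} (s σ : ℤˣ) (j : Fin k) (w : ℕ) :
    ‖svetlichnyPhase s σ j w‖ = 1 := by
  refine (pow_eq_one_iff_of_nonneg (norm_nonneg _) (four_ne_zero)).1 ?_
  rw [← norm_pow, svetlichnyPhase_pow_four]
  split_ifs <;> simp

theorem isBalancedPhase_svetlichnyPhase {k : ℕ} (s σ : ℤˣ) (j : Fin k) {I : Type*} [Fintype I]
    [DecidableEq I] [Nonempty I] :
    IsBalancedPhase (fun x : I → Fin 2 => svetlichnyPhase s σ j (hammingWeight x))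
      (if (j : ℕ) = 0 then -1 else 1) where
  norm_eq _ := norm_svetlichnyPhase s σ j _
  pow_four _ := svetlichnyPhase_pow_four s σ j _
  sum_sq := by
    simp only [svetlichnyPhase, mul_pow, ← Finset.mul_sum]
    simp only [← pow_mul, mul_comm _ 2, pow_mul Complex.I 2, Complex.I_sq,
      sum_neg_one_pow_hammingWeight, mul_zero]

theorem prod_ite_val_eq_zero {k : ℕ} (hk : 2 ≤ k) (a : ℂ) :
    ∏ j : Fin k, (if (j : ℕ) = 0 then a else 1) = a := by
  have h : ∀ j : Fin k, (j : ℕ) = 0 ↔ j = ⟨0, by omega⟩ := fun j => by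
    rw [Fin.ext_iff]
  simp [h]

theorem svetlichnyCoeff_add_two (s : ℤˣ) (w : ℕ) :
    svetlichnyCoeff s (w + 2) = -svetlichnyCoeff s w := by
  -- The exponent grows by the odd number `2 (w + 1) + s`, hence the change of sign.
  have h : (((w + 2 : ℕ) : ℤ) * (((w + 2 : ℕ) : ℤ) + (s : ℤ)) / 2) =
      (w : ℤ) * ((w : ℤ) + (s : ℤ)) / 2 + (2 * (w + 1) + (s : ℤ)) := by
    rw [← Int.add_mul_ediv_right _ _ (by norm_num : (2 : ℤ) ≠ 0)]
    congr 1
    push_cast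
    ring
  rw [svetlichnyCoeff, svetlichnyCoeff, h, zpow_add₀ (by norm_num), zpow_add₀ (by norm_num),
    zpow_mul]
  rcases Int.units_eq_one_or s with rfl | rfl <;> simp

/-- Both sides change sign under `w ↦ w + 2`, so the weights `0` and `1` decide. -/
theorem svetlichnyCoeff_eq_re (s : ℤˣ) (w : ℕ) :
    svetlichnyCoeff s w = ((1 + ((s : ℤ) : ℂ) * Complex.I) * Complex.I ^ w).re := by
  induction w using Nat.twoStepInduction with
  | zero => simp [svetlichnyCoeff]
  | one => rcases Int.units_eq_one_or s with rfl | rfl <;> simp [svetlichnyCoeff]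
  | more w ih _ =>
    rw [svetlichnyCoeff_add_two, ih, pow_add, Complex.I_sq]
    simp

theorem prod_svetlichnyPhase {N k : ℕ} (hk : 2 ≤ k) (c : Fin N → Fin k) (s σ : ℤˣ)
    (x : Fin N → Fin 2) :
    ∏ j, svetlichnyPhase s σ j (hammingWeight (clusterPart c j x)) =
      ((σ : ℤ) : ℂ) * ((1 / Real.sqrt 2 : ℝ) : ℂ) * (1 + ((s : ℤ) : ℂ) * Complex.I) *
        Complex.I ^ hammingWeight x := by
  simp only [svetlichnyPhase]
  rw [Finset.prod_mul_distrib, prod_ite_val_eq_zero hk, Finset.prod_pow_eq_pow_sum,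
    ← hammingWeight_eq_sum]

theorem re_prod_svetlichnyPhase {N k : ℕ} (hk : 2 ≤ k) (c : Fin N → Fin k) (s σ : ℤˣ)
    (x : Fin N → Fin 2) :
    (∏ j, svetlichnyPhase s σ j (hammingWeight (clusterPart c j x))).re =
      (σ : ℤ) * (1 / Real.sqrt 2) * svetlichnyCoeff s (hammingWeight x) := by
  rw [prod_svetlichnyPhase hk, svetlichnyCoeff_eq_re, mul_assoc (_ * _)]
  have : ((σ : ℤ) : ℂ) * ((1 / Real.sqrt 2 : ℝ) : ℂ) = (((σ : ℤ) * (1 / Real.sqrt 2) : ℝ) : ℂ) := by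
    push_cast; rfl
  rw [this, Complex.re_ofReal_mul]

theorem svetlichnyCoeff_sq (s : ℤˣ) (w : ℕ) : svetlichnyCoeff s w ^ 2 = 1 := by
  rw [svetlichnyCoeff, ← zpow_natCast, ← zpow_mul, mul_comm, zpow_mul]
  simp

/-! ### The reference experiment -/

theorem pauliObservable_eq (w : ℕ) :
    pauliObservable w = !![0, star (Complex.I ^ w); Complex.I ^ w, 0] := by
  rw [Complex.I_pow_eq_pow_mod, pauliObservable]
  have h : w % 4 < 4 := Nat.mod_lt _ (by norm_num)
  generalize w % 4 = r at h
  interval_cases r <;> simp [pauliX, pauliY]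

theorem targetObservable_eq {k : ℕ} (s σ : ℤˣ) (j : Fin k) (w : ℕ) :
    targetObservable s σ j w =
      !![0, star (svetlichnyPhase s σ j w); svetlichnyPhase s σ j w, 0] := by
  rw [targetObservable, svetlichnyPhase]
  split_ifs
  · rw [pauliObservable_eq, pauliObservable_eq, pow_succ]
    ext a b
    fin_cases a <;> fin_cases b <;> simp <;> ring
  · rw [pauliObservable_eq, one_mul]

theorem sum_ghz_mul {k : ℕ} (hk : 2 ≤ k) (f : (Fin k → Fin 2) → ℂ) :
    ∑ τ, f τ * ghz k τ = (f 0 + f 1) * ((1 / Real.sqrt 2 : ℝ) : ℂ) := by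
  have h01 : (0 : Fin k → Fin 2) ≠ 1 := fun h => by
    have := congrFun h ⟨0, by omega⟩
    simp at this
  have h0 : ∀ τ : Fin k → Fin 2, (∀ j, τ j = 0) ↔ τ = 0 := fun τ => funext_iff.symm
  have h1 : ∀ τ : Fin k → Fin 2, (∀ j, τ j = 1) ↔ τ = 1 := fun τ => funext_iff.symm
  have : ∀ τ, f τ * ghz k τ = (if τ = 0 then f 0 * ((1 / Real.sqrt 2 : ℝ) : ℂ) else 0) +
      if τ = 1 then f 1 * ((1 / Real.sqrt 2 : ℝ) : ℂ) else 0 := fun τ => by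
    simp only [ghz, h0, h1]
    by_cases e0 : τ = 0
    · subst e0; simp [h01]
    · by_cases e1 : τ = 1
      · subst e1; simp [h01.symm]
      · simp [e0, e1]
  simp only [this, Finset.sum_add_distrib, Finset.sum_ite_eq', Finset.mem_univ, if_true]
  ring

/-- Antidiagonal factors flip every qubit, so the two basis states of the GHZ vector are exchanged,
each picking up a product of phases. -/
theorem qubitOperator_mulVec_ghz {k : ℕ} (hk : 2 ≤ k) (w : Fin k → ℂ) (τ : Fin k → Fin 2) :
    (qubitOperator fun j => !![0, star (w j); w j, 0]).mulVec (ghz k) τ =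
      ((if ∀ j, τ j = 0 then ∏ j, star (w j) else 0) + if ∀ j, τ j = 1 then ∏ j, w j else 0) *
        ((1 / Real.sqrt 2 : ℝ) : ℂ) := by
  have hb : ∀ b : Fin 2, b ≠ 0 → b = 1 := by decide
  rw [Matrix.mulVec, dotProduct, sum_ghz_mul hk, add_comm]
  simp only [qubitOperator, Matrix.of_apply, Pi.zero_apply, Pi.one_apply]
  congr 2
  · split_ifs with h
    · exact Finset.prod_congr rfl fun j _ => by rw [h j]; rfl
    · push Not at h
      obtain ⟨j, hj⟩ := h
      exact Finset.prod_eq_zero (Finset.mem_univ j) (by rw [hb _ hj]; rfl)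
  · split_ifs with h
    · exact Finset.prod_congr rfl fun j _ => by rw [h j]; rfl
    · push Not at h
      obtain ⟨j, hj⟩ := h
      have : τ j = 0 := by by_contra h0; exact hj (hb _ h0)
      exact Finset.prod_eq_zero (Finset.mem_univ j) (by rw [this]; rfl)

theorem referenceCorrelator_eq {N k : ℕ} (hk : 2 ≤ k) (c : Fin N → Fin k) (s σ : ℤˣ)
    (x : Fin N → Fin 2) : referenceCorrelator c s σ x =
      (((σ : ℤ) * (1 / Real.sqrt 2) * svetlichnyCoeff s (hammingWeight x) : ℝ) : ℂ) := by
  rw [← re_prod_svetlichnyPhase hk c, referenceCorrelator]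
  simp only [targetObservable_eq]
  set w : Fin k → ℂ := fun j => svetlichnyPhase s σ j (hammingWeight (clusterPart c j x))
  have hstar : star (ghz k) = ghz k := by
    funext τ
    simp only [Pi.star_apply, ghz]
    split_ifs <;> simp
  rw [hstar, dotProduct_comm, dotProduct, sum_ghz_mul hk, qubitOperator_mulVec_ghz hk w,
    qubitOperator_mulVec_ghz hk w]
  have e0 : ∀ j : Fin k, (0 : Fin k → Fin 2) j = 0 := fun _ => rfl
  have e3 : ∀ j : Fin k, (1 : Fin k → Fin 2) j = 1 := fun _ => rfl
  have e1 : ¬ ∀ j : Fin k, (0 : Fin k → Fin 2) j = 1 := fun h => by simpa using h ⟨0, by omega⟩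
  have e2 : ¬ ∀ j : Fin k, (1 : Fin k → Fin 2) j = 0 := fun h => by simpa using h ⟨0, by omega⟩
  rw [if_pos e0, if_neg e1, if_neg e2, if_pos e3, add_zero, zero_add,
    ← star_prod, ← add_mul, mul_assoc, ← sq, inv_sqrt_two_sq, add_comm]
  have := Complex.add_conj (∏ j, w j)
  rw [Complex.star_def, this]
  push_cast
  ring

theorem sum_referenceCorrelator {N k : ℕ} (hk : 2 ≤ k) (hN : N ≠ 0) (c : Fin N → Fin k)
    (s σ : ℤˣ) :
    ∑ x : Fin N → Fin 2, ((svetlichnyCoeff s (hammingWeight x) : ℝ) : ℂ) *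
      referenceCorrelator c s σ x = (((σ : ℤ) * (2 ^ (N - 1) * Real.sqrt 2) : ℝ) : ℂ) := by
  simp only [referenceCorrelator_eq hk, ← Complex.ofReal_mul]
  rw [← Complex.ofReal_sum]
  congr 1
  have : ∀ x : Fin N → Fin 2, svetlichnyCoeff s (hammingWeight x) *
      ((σ : ℤ) * (1 / Real.sqrt 2) * svetlichnyCoeff s (hammingWeight x)) =
        (σ : ℤ) * (1 / Real.sqrt 2) := fun x => by
    linear_combination ((σ : ℤ) * (1 / Real.sqrt 2) : ℝ) * svetlichnyCoeff_sq s (hammingWeight x)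
  simp only [this, Finset.sum_const, Finset.card_univ, Fintype.card_pi, Fintype.card_fin,
    Finset.prod_const, nsmul_eq_mul]
  have h2 : Real.sqrt 2 ≠ 0 := by positivity
  have h3 : Real.sqrt 2 ^ 2 = 2 := Real.sq_sqrt (by norm_num)
  push_cast
  rw [← mul_pow_sub_one hN (2 : ℝ)]
  field_simp
  rw [h3]

/-! ### Value of the Svetlichny expression of a strategy -/

/-- A self-adjoint operator between `-1` and `1` is a contraction. -/
theorem norm_le_one_of_sub_nonneg_of_add_nonneg {H : Type*} [NormedAddCommGroup H]
    [InnerProductSpace ℂ H] [CompleteSpace H] {A : H →L[ℂ] H} (hA : IsSelfAdjoint A)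
    (h1 : 0 ≤ 1 - A) (h2 : 0 ≤ 1 + A) : ‖A‖ ≤ 1 := by
  -- The commuting nonnegative operators `1 - A` and `1 + A` have a nonnegative product, that is `A
  -- * A ≤ 1`.
  have hc : Commute (1 - A) (1 + A) := by
    rw [Commute, SemiconjBy]; noncomm_ring
  have h3 := hc.mul_nonneg h1 h2
  have h4 : (1 - A) * (1 + A) = 1 - A * A := by noncomm_ring
  rw [h4, sub_nonneg] at h3
  have h5 : 0 ≤ A * A := by
    have := star_mul_self_nonneg A
    rwa [hA.star_eq] at this
  have h6 := (CStarAlgebra.norm_le_one_iff_of_nonneg (A * A) h5).2 h3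
  rw [hA.norm_mul_self] at h6
  exact (pow_le_one_iff_of_nonneg (norm_nonneg _) two_ne_zero).1 h6

namespace ClusterStrategy

variable {N k : ℕ} {c : Fin N → Fin k} (S : ClusterStrategy.{u, v} c)

theorem effect_nonneg (j : Fin k) (x a : ClusterBits c j) : 0 ≤ S.effect j x a :=
  (ContinuousLinearMap.nonneg_iff_isPositive _).2 (S.effect_pos j x a)

theorem observable_isSelfAdjoint (j : Fin k) (x : ClusterBits c j) :
    IsSelfAdjoint (S.observable j x) := by
  refine isSelfAdjoint_sum _ fun a _ => IsSelfAdjoint.smul ?_ (S.effect_nonneg j x a).isSelfAdjoint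
  simp [IsSelfAdjoint]

theorem norm_observable_le (j : Fin k) (x : ClusterBits c j) : ‖S.observable j x‖ ≤ 1 := by
  have hterm : ∀ a, 0 ≤ S.effect j x a - ((-1 : ℂ) ^ hammingWeight a) • S.effect j x a ∧
      0 ≤ S.effect j x a + ((-1 : ℂ) ^ hammingWeight a) • S.effect j x a := fun a => by
    have h := S.effect_nonneg j x a
    rcases neg_one_pow_eq_or ℂ (hammingWeight a) with e | e <;> rw [e] <;>
      simpa using add_nonneg h h
  have hsum : ∑ a, S.effect j x a = 1 := S.effect_sum j x
  refine norm_le_one_of_sub_nonneg_of_add_nonneg (S.observable_isSelfAdjoint j x) ?_ ?_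
  · rw [← hsum, observable, ← Finset.sum_sub_distrib]
    exact Finset.sum_nonneg fun a _ => (hterm a).1
  · rw [← hsum, observable, ← Finset.sum_add_distrib]
    exact Finset.sum_nonneg fun a _ => (hterm a).2

/-- Multilinear expansion of the observables over outcomes: strings chosen per cluster are the same
as global strings, and the parity signs multiply. -/
theorem inner_tensorOp_observable {p : (Fin N → Fin 2) → (Fin N → Fin 2) → ℝ}
    (hp : S.Realizes p) (x : Fin N → Fin 2) :
    (inner ℂ S.ψ (S.tensorOp (fun j => S.observable j (clusterPart c j x)) S.ψ) : ℂ) =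
      (correlator p x : ℂ) := by
  have hprob : ∀ a, (inner ℂ S.ψ (S.tensorOp
      (fun j => S.effect j (clusterPart c j x) (clusterPart c j a)) S.ψ) : ℂ) = p a x := fun a => by
    obtain ⟨T, hT, h⟩ := hp a x
    rw [← S.eq_tensorOp hT, h]
  simp only [← S.tensorOpMultilinear_apply, observable] at hprob ⊢
  rw [MultilinearMap.map_sum, ← (bijective_clusterPart c).sum_comp]
  simp only [MultilinearMap.map_smul_univ, sum_apply, smul_apply, inner_sum, inner_smul_right,
    hprob, Finset.prod_pow_eq_pow_sum, ← hammingWeight_eq_sum, correlator]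
  push_cast
  rfl

/-- The ladder operator of cluster `j` extracted from its observables. -/
noncomputable def ladder (s σ : ℤˣ) : S.LocalOps := fun j =>
  phaseAverage (fun x : ClusterBits c j => svetlichnyPhase s σ j (hammingWeight x))
    (S.observable j)

theorem re_inner_tensorOp_ladder (hk : 2 ≤ k) (s σ : ℤˣ)
    {p : (Fin N → Fin 2) → (Fin N → Fin 2) → ℝ} (hp : S.Realizes p) :
    2 ^ N * (inner ℂ S.ψ (S.tensorOp (S.ladder s σ) S.ψ) : ℂ).re =
      (σ : ℤ) * (1 / Real.sqrt 2) * svetlichny s p := by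
  have hcard : (Fintype.card (∀ j, ClusterBits c j) : ℂ) = 2 ^ N := by
    rw [← Fintype.card_of_bijective (bijective_clusterPart c)]
    simp
  have h : (2 ^ N : ℂ) * inner ℂ S.ψ (S.tensorOp (S.ladder s σ) S.ψ) =
      ∑ x : Fin N → Fin 2, (∏ j, svetlichnyPhase s σ j (hammingWeight (clusterPart c j x))) *
        (correlator p x : ℂ) := by
    unfold ladder
    rw [S.tensorOp_phaseAverage, ← hcard, ← inner_smul_right, ← smul_apply, ← sum_phase_smul,
      ← (bijective_clusterPart c).sum_comp]
    simp only [sum_apply, smul_apply, inner_sum, inner_smul_right, S.inner_tensorOp_observable hp]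
  have h' := congrArg Complex.re h
  rw [← Complex.ofReal_ofNat, ← Complex.ofReal_pow, Complex.re_ofReal_mul, Complex.re_sum] at h'
  rw [h', svetlichny, Finset.mul_sum]
  refine Finset.sum_congr rfl fun x _ => ?_
  rw [mul_comm, Complex.re_ofReal_mul, re_prod_svetlichnyPhase hk]
  ring

theorem isBalancedPhase_clusterBits (hc : Function.Surjective c) (s σ : ℤˣ) (j : Fin k) :
    IsBalancedPhase (fun x : ClusterBits c j => svetlichnyPhase s σ j (hammingWeight x))
      (if (j : ℕ) = 0 then -1 else 1) := by
  obtain ⟨i, hi⟩ := hc j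
  have : Nonempty {i : Fin N // c i = j} := ⟨⟨i, hi⟩⟩
  exact isBalancedPhase_svetlichnyPhase s σ j

theorem norm_ladder_le (s σ : ℤˣ) (j : Fin k) : ‖S.ladder s σ j‖ ≤ 1 :=
  norm_phaseAverage_le (fun _ => norm_svetlichnyPhase s σ j _) (S.norm_observable_le j)

theorem mul_svetlichny_eq (hk : 2 ≤ k) (hN : N ≠ 0) (s σ : ℤˣ)
    {p : (Fin N → Fin 2) → (Fin N → Fin 2) → ℝ} (hp : S.Realizes p) :
    (σ : ℤ) * svetlichny s p =
      2 * (inner ℂ S.ψ (S.tensorOp (S.ladder s σ) S.ψ) : ℂ).re * (2 ^ (N - 1) * Real.sqrt 2) := by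
  have h1 := S.re_inner_tensorOp_ladder hk s σ hp
  have h2 : Real.sqrt 2 ≠ 0 := by positivity
  rw [← mul_pow_sub_one hN (2 : ℝ)] at h1
  field_simp at h1
  linear_combination -h1

theorem mul_svetlichny_le (hk : 2 ≤ k) (hN : N ≠ 0) (hc : Function.Surjective c) (s σ : ℤˣ)
    {p : (Fin N → Fin 2) → (Fin N → Fin 2) → ℝ} (hp : S.Realizes p) :
    (σ : ℤ) * svetlichny s p ≤ 2 ^ (N - 1) * Real.sqrt 2 := by
  have h2 : (inner ℂ S.ψ (S.tensorOp (S.ladder s σ) S.ψ) : ℂ).re ≤ 1 / 2 :=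
    S.re_inner_tensorOp_phaseAverage_le hk (isBalancedPhase_clusterBits hc s σ)
      S.observable_isSelfAdjoint S.norm_observable_le
  rw [S.mul_svetlichny_eq hk hN s σ hp]
  exact mul_le_of_le_one_left (by positivity) (by linarith)

theorem re_inner_ladder_of_svetlichny_eq (hk : 2 ≤ k) (hN : N ≠ 0) (s σ : ℤˣ)
    {p : (Fin N → Fin 2) → (Fin N → Fin 2) → ℝ} (hp : S.Realizes p)
    (hmax : svetlichny s p = (σ : ℤ) * (2 ^ (N - 1) * Real.sqrt 2)) :
    (inner ℂ S.ψ (S.tensorOp (S.ladder s σ) S.ψ) : ℂ).re = 1 / 2 := by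
  have h := S.mul_svetlichny_eq hk hN s σ hp
  have hσ : ((σ : ℤ) : ℝ) * (σ : ℤ) = 1 := by
    rcases Int.units_eq_one_or σ with rfl | rfl <;> simp
  rw [hmax, ← mul_assoc, hσ] at h
  have := mul_right_cancel₀ (by positivity) h
  linarith

end ClusterStrategy

/-- Maximal violation of a Svetlichny inequality self-tests the GHZ state and the target
observables. -/
theorem selfTests_of_svetlichny_eq {N k : ℕ} (hk : 2 ≤ k) (hN : N ≠ 0) (c : Fin N → Fin k)
    (hc : Function.Surjective c) (s σ : ℤˣ) (p : (Fin N → Fin 2) → (Fin N → Fin 2) → ℝ)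
    (hmax : svetlichny s p = (σ : ℤ) * (2 ^ (N - 1) * Real.sqrt 2)) :
    SelfTests.{u, v} c p (ghz k) (fun j x => targetObservable s σ j (hammingWeight x)) := by
  intro S hp
  have heq := S.re_inner_ladder_of_svetlichny_eq hk hN s σ hp hmax
  obtain ⟨hrel, hobs⟩ := S.ghzRelations_of_re_inner_eq hk
    (ClusterStrategy.isBalancedPhase_clusterBits hc s σ) (prod_ite_val_eq_zero hk _)
    S.observable_isSelfAdjoint S.norm_observable_le heq
  change S.GHZRelations (S.ladder s σ) at hrel
  obtain ⟨V, Λ, hΛ, h0, h1⟩ := hrel.exists_isometry hk (S.norm_ladder_le s σ)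
  set ζ₀ := S.tensorOp (S.ladder s σ) S.ψ with hζ₀
  have h2 : Real.sqrt 2 ≠ 0 := by positivity
  have hsqrt : ((1 / Real.sqrt 2 : ℝ) : ℂ) * ((Real.sqrt 2 : ℝ) : ℂ) = 1 := by
    rw [← Complex.ofReal_mul, one_div_mul_cancel h2, Complex.ofReal_one]
  have hsplit := hrel.tensorOp_add_star ⟨0, by omega⟩
  -- `ζ₀` has squared norm `1/2`; the factor `√2` normalizes it and cancels the `1 / √2` of the GHZ
  -- amplitudes.
  refine ⟨V, Λ, ((Real.sqrt 2 : ℝ) : ℂ) • ζ₀, hΛ, ?_, ?_, fun x => ?_⟩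
  · have hn : ‖ζ₀‖ ^ 2 = 1 / 2 := (hrel.norm_sq_tensorOp hk).trans heq
    refine (pow_eq_one_iff_of_nonneg (norm_nonneg _) two_ne_zero).1 ?_
    rw [norm_smul, mul_pow, hn, Complex.norm_real, Real.norm_of_nonneg (Real.sqrt_nonneg _),
      Real.sq_sqrt (by norm_num)]
    norm_num
  · refine PiLp.ext fun τ => ?_
    rw [← hsplit, map_add, PiLp.add_apply, h0, h1]
    simp only [qubitsTensor, ghz, smul_smul]
    by_cases e0 : ∀ j, τ j = 0
    · have e1 : ¬ ∀ j, τ j = 1 := fun e1 => by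
        have := (e0 ⟨0, by omega⟩).symm.trans (e1 ⟨0, by omega⟩)
        simp at this
      rw [if_pos e0, if_neg e1, if_pos (Or.inl e0), hsqrt, one_smul, add_zero]
    · by_cases e1 : ∀ j, τ j = 1
      · rw [if_neg e0, if_pos e1, if_pos (Or.inr e1), hsqrt, one_smul, zero_add]
      · rw [if_neg e0, if_neg e1, if_neg (not_or.2 ⟨e0, e1⟩), zero_mul, zero_smul, add_zero]
  · refine ⟨_, S.isTensorOperator_tensorOp _, ?_⟩
    rw [hrel.tensorOp_apply_of_localOp_apply hk (fun j => hobs j (clusterPart c j x))]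
    simp only [targetObservable_eq]
    refine PiLp.ext fun τ => ?_
    rw [map_add, map_smul, map_smul, PiLp.add_apply, PiLp.smul_apply, PiLp.smul_apply, h0, h1]
    simp only [qubitsTensor]
    rw [qubitOperator_mulVec_ghz hk, smul_smul, mul_assoc, hsqrt, mul_one, add_smul, add_comm]
    simp only [smul_ite, ite_smul, smul_zero, zero_smul]

theorem mainTheorem8 {N k : ℕ} (hk : 2 ≤ k) (c : Fin N → Fin k)
    (hc : Function.Surjective c) (s : ℤˣ) :
    (∀ (S : ClusterStrategy.{u, v} c) (p : (Fin N → Fin 2) → (Fin N → Fin 2) → ℝ),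
      S.Realizes p → |svetlichny s p| ≤ 2 ^ (N - 1) * Real.sqrt 2) ∧
    ∀ σ : ℤˣ,
      (∑ x : Fin N → Fin 2,
          ((svetlichnyCoeff s (hammingWeight x) : ℝ) : ℂ) * referenceCorrelator c s σ x =
        (((σ : ℤ) * (2 ^ (N - 1) * Real.sqrt 2) : ℝ) : ℂ)) ∧
      ∀ p : (Fin N → Fin 2) → (Fin N → Fin 2) → ℝ,
        svetlichny s p = (σ : ℤ) * (2 ^ (N - 1) * Real.sqrt 2) →
        SelfTests.{u, v} c p (ghz k)
          (fun j x => targetObservable s σ j (hammingWeight x)) := by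
  have hN : N ≠ 0 := by
    rintro rfl
    obtain ⟨i, -⟩ := hc ⟨0, by omega⟩
    exact i.elim0
  refine ⟨fun S p hp => ?_, fun σ => ⟨sum_referenceCorrelator hk hN c s σ, fun p hmax =>
    selfTests_of_svetlichny_eq hk hN c hc s σ p hmax⟩⟩
  -- The one-sided bounds for `σ = 1` and `σ = -1` combine into the absolute value.
  have h1 := S.mul_svetlichny_le hk hN hc s 1 hp
  have h2 := S.mul_svetlichny_le hk hN hc s (-1) hp
  simp only [Units.val_one, Units.val_neg, Int.cast_one, Int.cast_neg, one_mul, neg_mul] at h1 h2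
  exact abs_le.2 ⟨by linarith, h1⟩
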